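/- Let $k$ be a field and $n\ge 2$. **Diagrams.** A $k$-diagram $\mathcal F$ consists of $k$-vector spaces $\mathcal F(B_1),\mathcal F(B_2),\mathcal F(B_3),\mathcal F(A_1),\mathcal F(A_2)$ and linear maps $\rho_{11}:B_1\to A_1$, $\rho_{22}:B_2\to A_2$, $\rho_{31}:B_3\to A_1$, $\rho_{32}:B_3\to A_2$; isomorphisms and direct sums are taken value by value. $H^0(\mathcal F)$ and $H^1(\mathcal F)$ are the kernel and cokernel of $\partial(b_1,b_2,b_3)=(\rho_{11}b_1-\rho_{31}b_3,\ \rho_{22}b_2-\rho_{32}b_3)$, and $\mathcal F$ is Fredholm if both are finite dimensional. A virtual $k$-diagram (resp. virtual $k$-vector space) is a formal difference $\mathcal F_1\ominus\mathcal F_2$ of Fredholm $k$-diagrams (resp. of finite dimensional vector spaces); $\mathcal F_1\ominus\mathcal F_2$ and $\mathcal F_1'\ominus\mathcal F_2'$ are equivalent (isomorphic) if $\mathcal F_1\oplus\mathcal F_2'\oplus\mathcal F_0\simeq\mathcal F_1'\oplus\mathcal F_2\oplus\mathcal F_0$ for some $\mathcal F_0$ of the same kind. On classes, $H^i([\mathcal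 F_1\ominus\mathcal F_2])=[H^i(\mathcal F_1)\ominus H^i(\mathcal F_2)]$ and $[V_1\ominus V_2]^*=[V_1^*\ominus V_2^*]$. **Models.** For $W:\mathbb Z^2\to\mathbb Z_{\ge0}$ and $\mathbf d\in\mathbb Z^2$, $\mathcal M_{W,\mathbf d}$ has $B_i=k^{\oplus\mathbb Z_{\le d_i}}$, $A_i=k^{\oplus\mathbb Z}$, $B_3=k^{\oplus W}$ (one copy of $k$ for each element of the multiset with multiplicities $W$), with inclusions $\rho_{ii}$ and projections $\rho_{3i}$; and $\mathcal I_{\mathbf d}^{\oplus W}=\bigoplus_{\mathbf a}\mathcal I_{\mathbf d\ge\mathbf a}^{\oplus W(\mathbf a)}$, where $\mathcal I_{\mathbf d\ge\mathbf a}$ has values $k$ at $B_3,A_1,A_2$, value $k$ at $B_i$ if $a_i\le d_i$ and $0$ otherwise, and identities and inclusions as maps. A function on $\mathbb Z^n$ is initially (eventually) zero if it vanishes in all sufficiently small (large) degrees, where $\deg\mathbf d=d_1+\dots+d_n$. A perfect matching is an initially and eventually zero $W:\mathbb Z^2\to\mathbb Z$ that is the indicator function of the graph of a bijection $\mathbb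 Z\to\mathbb Z$. For any initially and eventually zero $W:\mathbb Z^2\to\mathbb Z$, $[\mathcal M_{W,\mathbf d}]$ denotes the class of $\mathcal I_{\mathbf d}^{\oplus W^+}\ominus\mathcal I_{\mathbf d}^{\oplus W^-}$, where $W^{\pm}=\max(\pm W,0)$. **Riemann functions.** $f:\mathbb Z^n\to\mathbb Z$ is a Riemann function with offset $C$ if it is initially zero and $f(\mathbf d)=\deg(\mathbf d)+C$ for $\deg\mathbf d$ sufficiently large; its $\mathbf K$-dual is $f^\wedge_{\mathbf K}(\mathbf d)=f(\mathbf K-\mathbf d)-\deg(\mathbf K-\mathbf d)-C$. For $i\neq j$ put $f_{i,j,\mathbf d}(a_1,a_2)=f(\mathbf d+a_1\mathbf e_i+a_2\mathbf e_j)$; for $g:\mathbb Z^2\to\mathbb Z$ put $(\mathfrak m g)(\mathbf a)=\sum_{I\subset\{1,2\}}(-1)^{|I|}g(\mathbf a-\mathbf e_I)$; and put $W^*_{\mathbf L}(\mathbf a)=W(\mathbf L-\mathbf a)$. Let $[\mathcal M_{f;i,j,\mathbf d}]=[\mathcal M_{\mathfrak m f_{i,j,\mathbf d},\mathbf 0}]$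 and $[\mathcal M_{f\text{ at }\mathbf d}]=[\mathcal M_{f;1,2,\mathbf d}]$. **Theorem.** Let $f:\mathbb Z^n\to\mathbb Z$ be an arbitrary Riemann function and $\mathbf d,\mathbf K\in\mathbb Z^n$. 1. For all distinct $i,j$, $[\mathcal M_{f;i,j,\mathbf d}]=[\mathcal M_{f\text{ at }\mathbf d}]$. Whenever $\mathfrak m f_{i,j,\mathbf d}=(W_1+\dots+W_s)-(\tilde W_1+\dots+\tilde W_{s-1})$ with all $W_\ell,\tilde W_\ell$ perfect matchings, all $\mathcal M_{W_\ell,\mathbf 0}$ and $\mathcal M_{\tilde W_\ell,\mathbf 0}$ are Fredholm and this class is that of $\bigoplus_\ell\mathcal M_{W_\ell,\mathbf 0}\ominus\bigoplus_\ell\mathcal M_{\tilde W_\ell,\mathbf 0}$; such a decomposition exists if $\mathfrak m f_{i,j,\mathbf d}$ is bounded. 2. For $i=0,1$ there is an isomorphism of virtual $k$-vector spaces $$H^i\bigl([\mathcal M_{f\text{ at }\mathbf d}]\bigr)^*\to H^{1-i}\bigl([\mathcal M_{f^\wedge_{\mathbf K}\text{ at }\mathbf K-\mathbf d}]\bigr).$$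 3. It arises from two-variable duality: let $\mathbf d'=\mathbf d-d_1\mathbf e_1-d_2\mathbf e_2$, $W=\mathfrak m f_{1,2,\mathbf d'}$, $\delta=(d_1,d_2)$, $\kappa=(K_1,K_2)$, $\mathbf L=\kappa+(1,1)$. Then $[\mathcal M_{f\text{ at }\mathbf d}]=[\mathcal M_{W,\delta}]$ and $[\mathcal M_{f^\wedge_{\mathbf K}\text{ at }\mathbf K-\mathbf d}]=[\mathcal M_{W^*_{\mathbf L},\kappa-\delta}]$. For every decomposition $W=\sum_{\ell\le s}W_\ell-\sum_{\ell\le s-1}\tilde W_\ell$ into perfect matchings, these two classes are those of $\bigoplus_\ell\mathcal M_{W_\ell,\delta}\ominus\bigoplus_\ell\mathcal M_{\tilde W_\ell,\delta}$ and $\bigoplus_\ell\mathcal M_{(W_\ell)^*_{\mathbf L},\kappa-\delta}\ominus\bigoplus_\ell\mathcal M_{(\tilde W_\ell)^*_{\mathbf L},\kappa-\delta}$, and there are isomorphisms of vector spaces $$H^i\Bigl(\bigoplus_\ell\mathcal M_{W_\ell,\delta}\Bigr)^*\to H^{1-i}\Bigl(\bigoplus_\ell\mathcal M_{(W_\ell)^*_{\mathbf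 L},\kappa-\delta}\Bigr),\qquad i=0,1,$$ and likewise for the $\tilde W_\ell$. For $i=1$ the isomorphism sends a functional $w$ to the global section whose coefficient at the basis vector $\mathbf e_m$ ($m\le K_1-d_1$) of the $\ell$-th summand of $B_1$ is $w$ of the class of $(\mathbf e_{K_1+1-m},0)$ in the $\ell$-th summand of $A_1\oplus A_2$; for $i=0$ it is the transpose of the corresponding $i=1$ isomorphism with the two sides exchanged. The same holds with any two distinct coordinates in place of $1,2$. -/

import Mathlib

universe u v

/-! ### Functions on `ℤⁿ`: Riemann functions, duals, restrictions, weights -/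

/-- The degree `d₁ + ⋯ + dₙ` of `d ∈ ℤⁿ`. -/
def deg {n : ℕ} (d : Fin n → ℤ) : ℤ := ∑ i, d i

/-- `W` vanishes in all sufficiently small degrees. -/
def InitiallyZero {n : ℕ} (W : (Fin n → ℤ) → ℤ) : Prop :=
  ∃ a : ℤ, ∀ d, deg d ≤ a → W d = 0

/-- `W` vanishes in all sufficiently large degrees. -/
def EventuallyZero {n : ℕ} (W : (Fin n → ℤ) → ℤ) : Prop :=
  ∃ b : ℤ, ∀ d, b ≤ deg d → W d = 0

/-- `f : ℤⁿ → ℤ` is a Riemann function with offset `C`. -/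
def IsRiemannFunction {n : ℕ} (f : (Fin n → ℤ) → ℤ) (C : ℤ) : Prop :=
  InitiallyZero f ∧ ∃ b : ℤ, ∀ d, b ≤ deg d → f d = deg d + C

/-- The `K`-dual `f^∧_K` of a Riemann function `f` with offset `C`. -/
def riemannDual {n : ℕ} (f : (Fin n → ℤ) → ℤ) (C : ℤ) (K : Fin n → ℤ) : (Fin n → ℤ) → ℤ :=
  fun d => f (K - d) - deg (K - d) - C

/-- The two-variable restriction `f_{i,j,d}(a₁, a₂) = f (d + a₁ eᵢ + a₂ eⱼ)`. -/
def restrictTwo {n : ℕ} (f : (Fin n → ℤ) → ℤ) (i j : Fin n) (d : Fin n → ℤ) :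
    (Fin 2 → ℤ) → ℤ :=
  fun a => f (d + Pi.single i (a 0) + Pi.single j (a 1))

/-- The weight `𝔪 f` of `f`: `(𝔪 f)(d) = ∑_{I ⊆ [n]} (-1)^{|I|} f (d - e_I)`. -/
def weight {n : ℕ} (f : (Fin n → ℤ) → ℤ) : (Fin n → ℤ) → ℤ :=
  fun d => ∑ I : Finset (Fin n), (-1) ^ I.card * f (d - ∑ i ∈ I, Pi.single i 1)

/-- The `L`-dual weight `W^*_L (d) = W (L - d)`. -/
def dualWeight {n : ℕ} (W : (Fin n → ℤ) → ℤ) (L : Fin n → ℤ) : (Fin n → ℤ) → ℤ :=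
  fun d => W (L - d)

/-- `W : ℤ² → ℤ` is a perfect matching: it is initially and eventually zero, and it is the
indicator function of the graph of a bijection `π : ℤ → ℤ`. -/
def IsPerfectMatching (W : (Fin 2 → ℤ) → ℤ) : Prop :=
  InitiallyZero W ∧ EventuallyZero W ∧
    ∃ π : Equiv.Perm ℤ, ∀ a, W a = if a 1 = π (a 0) then 1 else 0

/-- A way of writing `W : ℤ² → ℤ` as `(W₁ + ⋯ + W_s) - (W̃₁ + ⋯ + W̃_{s-1})` with all `W_ℓ` and
`W̃_ℓ` perfect matchings; here `s = r + 1`. -/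
structure MatchingDecomposition (W : (Fin 2 → ℤ) → ℤ) where
  r : ℕ
  pos : Fin (r + 1) → (Fin 2 → ℤ) → ℤ
  neg : Fin r → (Fin 2 → ℤ) → ℤ
  pos_perfect : ∀ l, IsPerfectMatching (pos l)
  neg_perfect : ∀ l, IsPerfectMatching (neg l)
  eq_sub : ∀ a, W a = ∑ l, pos l a - ∑ l, neg l a

section RiemannLemmas

variable {n : ℕ}

lemma deg_add (x y : Fin n → ℤ) : deg (x + y) = deg x + deg y := by
  simp [deg, Finset.sum_add_distrib]

lemma deg_sub (x y : Fin n → ℤ) : deg (x - y) = deg x - deg y := by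
  simp [deg, Finset.sum_sub_distrib]

lemma deg_single (i : Fin n) (t : ℤ) : deg (Pi.single i t) = t := by
  simp [deg]

lemma IsRiemannFunction.riemannDual {f : (Fin n → ℤ) → ℤ} {C : ℤ}
    (hf : IsRiemannFunction f C) (K : Fin n → ℤ) :
    IsRiemannFunction (riemannDual f C K) (-deg K - C) := by
  obtain ⟨⟨a, ha⟩, b, hb⟩ := hf
  refine ⟨⟨deg K - b, fun d hd => ?_⟩, deg K - a, fun d hd => ?_⟩
  · have h := hb (K - d) (by rw [deg_sub]; linarith)
    simp [_root_.riemannDual, h]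
  · have h := ha (K - d) (by rw [deg_sub]; linarith)
    simp only [_root_.riemannDual, h, deg_sub]
    ring

lemma IsRiemannFunction.restrictTwo {f : (Fin n → ℤ) → ℤ} {C : ℤ}
    (hf : IsRiemannFunction f C) (i j : Fin n) (d : Fin n → ℤ) :
    IsRiemannFunction (restrictTwo f i j d) (deg d + C) := by
  obtain ⟨⟨a, ha⟩, b, hb⟩ := hf
  have key : ∀ x : Fin 2 → ℤ,
      deg (d + Pi.single i (x 0) + Pi.single j (x 1)) = deg d + deg x := by
    intro x
    rw [deg_add, deg_add, deg_single, deg_single]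
    simp only [deg, Fin.sum_univ_two]
    ring
  refine ⟨⟨a - deg d, fun x hx => ?_⟩, b - deg d, fun x hx => ?_⟩
  · exact ha _ (by rw [key]; linarith)
  · rw [_root_.restrictTwo, hb _ (by rw [key]; linarith), key]
    ring

lemma weight_two (f : (Fin 2 → ℤ) → ℤ) (d : Fin 2 → ℤ) :
    weight f d = f d - f (d - Pi.single 0 1) - f (d - Pi.single 1 1)
      + f (d - (Pi.single 0 1 + Pi.single 1 1)) := by
  have h : (Finset.univ : Finset (Finset (Fin 2))) = {∅, {0}, {1}, {0, 1}} := by decide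
  rw [weight, h, Finset.sum_insert (by decide), Finset.sum_insert (by decide),
    Finset.sum_insert (by decide), Finset.sum_singleton]
  simp
  ring

lemma IsRiemannFunction.weight_initiallyZero {f : (Fin 2 → ℤ) → ℤ} {C : ℤ}
    (hf : IsRiemannFunction f C) : InitiallyZero (weight f) := by
  obtain ⟨⟨a, ha⟩, -⟩ := hf
  refine ⟨a, fun d hd => ?_⟩
  rw [weight_two, ha _ hd, ha _ (by rw [deg_sub, deg_single]; linarith),
    ha _ (by rw [deg_sub, deg_single]; linarith),
    ha _ (by rw [deg_sub, deg_add, deg_single, deg_single]; linarith)]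
  ring

lemma IsRiemannFunction.weight_eventuallyZero {f : (Fin 2 → ℤ) → ℤ} {C : ℤ}
    (hf : IsRiemannFunction f C) : EventuallyZero (weight f) := by
  obtain ⟨-, b, hb⟩ := hf
  refine ⟨b + 2, fun d hd => ?_⟩
  rw [weight_two, hb _ (by linarith), hb _ (by rw [deg_sub, deg_single]; linarith),
    hb _ (by rw [deg_sub, deg_single]; linarith),
    hb _ (by rw [deg_sub, deg_add, deg_single, deg_single]; linarith)]
  simp only [deg_sub, deg_add, deg_single]
  ring

lemma InitiallyZero.dualWeight {W : (Fin n → ℤ) → ℤ} (h : InitiallyZero W) (L : Fin n → ℤ) :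
    EventuallyZero (dualWeight W L) := by
  obtain ⟨a, ha⟩ := h
  exact ⟨deg L - a, fun d hd => ha _ (by rw [deg_sub]; linarith)⟩

lemma EventuallyZero.dualWeight {W : (Fin n → ℤ) → ℤ} (h : EventuallyZero W) (L : Fin n → ℤ) :
    InitiallyZero (dualWeight W L) := by
  obtain ⟨b, hb⟩ := h
  exact ⟨deg L - b, fun d hd => hb _ (by rw [deg_sub]; linarith)⟩

end RiemannLemmas

/-! ### Formal differences -/

/-- A notion of objects (vector spaces, diagrams, …) with isomorphisms and binary direct sums. -/
class HasIsoSum (α : Type v) where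
  Iso : α → α → Prop
  sum : α → α → α
  iso_equivalence : Equivalence Iso
  sum_congr : ∀ {a a' b b'}, Iso a a' → Iso b b' → Iso (sum a b) (sum a' b')
  sum_comm : ∀ a b, Iso (sum a b) (sum b a)
  sum_assoc : ∀ a b c, Iso (sum (sum a b) c) (sum a (sum b c))

namespace HasIsoSum

variable {α : Type v} [HasIsoSum α]

/-- `(F₁, F₂) ∼ (F₁', F₂')` iff `F₁ ⊕ F₂' ⊕ F₀ ≃ F₁' ⊕ F₂ ⊕ F₀` for some `F₀`. -/
def VirtualRel (x y : α × α) : Prop :=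
  ∃ c : α, Iso (sum (sum x.1 y.2) c) (sum (sum y.1 x.2) c)

lemma virtualRel_equivalence : Equivalence (VirtualRel (α := α)) := by
  let S : Setoid α := ⟨Iso, iso_equivalence⟩
  let q : α → Quotient S := Quotient.mk S
  let add : Quotient S → Quotient S → Quotient S :=
    Quotient.map₂ sum (fun _ _ h _ _ h' => sum_congr h h')
  have hadd : ∀ a b, q (sum a b) = add (q a) (q b) := fun a b => rfl
  have : Std.Commutative add := ⟨fun a b => by
    induction a using Quotient.inductionOn
    induction b using Quotient.inductionOn
    exact Quotient.sound (sum_comm _ _)⟩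
  have : Std.Associative add := ⟨fun a b c => by
    induction a using Quotient.inductionOn
    induction b using Quotient.inductionOn
    induction c using Quotient.inductionOn
    exact Quotient.sound (sum_assoc _ _ _)⟩
  have hiff : ∀ a b, Iso a b ↔ q a = q b := fun a b =>
    ⟨fun h => Quotient.sound h, fun h => Quotient.exact h⟩
  refine ⟨fun x => ⟨x.1, iso_equivalence.refl _⟩, ?_, ?_⟩
  · rintro x y ⟨c, h⟩
    exact ⟨c, iso_equivalence.symm h⟩
  · rintro x y z ⟨c, h⟩ ⟨c', h'⟩
    refine ⟨sum (sum y.1 y.2) (sum c c'), ?_⟩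
    rw [hiff] at *
    simp only [hadd] at *
    calc _ = add (add (add (q x.1) (q y.2)) (q c)) (add (add (q y.1) (q z.2)) (q c')) := by
          ac_rfl
      _ = add (add (add (q y.1) (q x.2)) (q c)) (add (add (q z.1) (q y.2)) (q c')) := by
          rw [h, h']
      _ = _ := by ac_rfl

/-- The equivalence of formal differences. -/
def virtualSetoid (α : Type v) [HasIsoSum α] : Setoid (α × α) :=
  ⟨VirtualRel, virtualRel_equivalence⟩

end HasIsoSum

/-- Equivalence classes of virtual objects (formal differences `F₁ ⊖ F₂`). -/
def Virtual (α : Type v) [HasIsoSum α] : Type v := Quotient (HasIsoSum.virtualSetoid α)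

namespace Virtual

open HasIsoSum

variable {α β : Type*} [HasIsoSum α] [HasIsoSum β]

/-- The class `[F₁ ⊖ F₂]`. -/
def mk (F₁ F₂ : α) : Virtual α := Quotient.mk (virtualSetoid α) (F₁, F₂)

/-- An operation `h` that respects isomorphisms and direct sums extends to classes by
`h [F₁ ⊖ F₂] = [h F₁ ⊖ h F₂]`. -/
def map (h : α → β) (hiso : ∀ a b, Iso a b → Iso (h a) (h b))
    (hsum : ∀ a b, Iso (h (HasIsoSum.sum a b)) (HasIsoSum.sum (h a) (h b))) :
    Virtual α → Virtual β :=
  Quotient.map' (s₁ := virtualSetoid α) (s₂ := virtualSetoid β) (fun x => (h x.1, h x.2)) (by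
    rintro x y ⟨c, hc⟩
    have E := iso_equivalence (α := β)
    have e : ∀ a b c : α, Iso (h (HasIsoSum.sum (HasIsoSum.sum a b) c))
        (HasIsoSum.sum (HasIsoSum.sum (h a) (h b)) (h c)) := fun a b c =>
      E.trans (hsum _ _) (sum_congr (hsum _ _) (E.refl _))
    exact ⟨h c, E.trans (E.symm (e _ _ _)) (E.trans (hiso _ _ hc) (e _ _ _))⟩)

end Virtual

/-! ### Virtual vector spaces -/

section VirtualVectorSpaces

variable {k : Type u} [Field k]

noncomputable instance : HasIsoSum (FGModuleCat.{u} k) where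
  Iso V W := Nonempty (V ≃ₗ[k] W)
  sum V W := FGModuleCat.of k (V × W)
  iso_equivalence := ⟨fun _ => ⟨LinearEquiv.refl k _⟩, fun ⟨e⟩ => ⟨e.symm⟩,
    fun ⟨e⟩ ⟨e'⟩ => ⟨e.trans e'⟩⟩
  sum_congr := fun ⟨e⟩ ⟨e'⟩ => ⟨LinearEquiv.prodCongr e e'⟩
  sum_comm V W := ⟨LinearEquiv.prodComm k V W⟩
  sum_assoc U V W := ⟨LinearEquiv.prodAssoc k U V W⟩

/-- The dual of a virtual (finite dimensional) vector space: `(V₁ ⊖ V₂)^* = V₁^* ⊖ V₂^*`. -/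
noncomputable def Virtual.dual : Virtual (FGModuleCat.{u} k) → Virtual (FGModuleCat.{u} k) :=
  Virtual.map (fun V => FGModuleCat.of k (Module.Dual k V))
    (fun _ _ ⟨e⟩ => ⟨e.symm.dualMap⟩)
    (fun V W => ⟨(Module.dualProdDualEquivDual k V W).symm⟩)

end VirtualVectorSpaces

/-! ### Diagrams of vector spaces -/

/-- A `k`-diagram: five `k`-vector spaces and four linear maps
`ρ₁₁ : B₁ → A₁`, `ρ₂₂ : B₂ → A₂`, `ρ₃₁ : B₃ → A₁`, `ρ₃₂ : B₃ → A₂`. -/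
structure KDiagram (k : Type u) [Field k] where
  (B₁ B₂ B₃ A₁ A₂ : ModuleCat.{u} k)
  ρ₁₁ : B₁ →ₗ[k] A₁
  ρ₂₂ : B₂ →ₗ[k] A₂
  ρ₃₁ : B₃ →ₗ[k] A₁
  ρ₃₂ : B₃ →ₗ[k] A₂

namespace KDiagram

variable {k : Type u} [Field k]

/-- The differential `∂ (b₁, b₂, b₃) = (ρ₁₁ b₁ - ρ₃₁ b₃, ρ₂₂ b₂ - ρ₃₂ b₃)`. -/
def diff (F : KDiagram k) : (F.B₁ × F.B₂ × F.B₃) →ₗ[k] (F.A₁ × F.A₂) where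
  toFun b := (F.ρ₁₁ b.1 - F.ρ₃₁ b.2.2, F.ρ₂₂ b.2.1 - F.ρ₃₂ b.2.2)
  map_add' x y := by ext <;> simp <;> abel
  map_smul' c x := by ext <;> simp [smul_sub]

/-- The zeroth cohomology group, the kernel of the differential. -/
abbrev H0 (F : KDiagram k) : Submodule k (F.B₁ × F.B₂ × F.B₃) := LinearMap.ker F.diff

/-- The first cohomology group, the cokernel of the differential. -/
abbrev H1 (F : KDiagram k) : Type u := (F.A₁ × F.A₂) ⧸ LinearMap.range F.diff

/-- The diagram has finite Betti numbers. -/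
structure IsFredholm (F : KDiagram k) : Prop where
  finite_H0 : Module.Finite k F.H0
  finite_H1 : Module.Finite k F.H1

/-- An isomorphism of diagrams: invertible linear maps between corresponding values, commuting
with the restriction maps. -/
structure Iso (F G : KDiagram k) where
  φB₁ : F.B₁ ≃ₗ[k] G.B₁
  φB₂ : F.B₂ ≃ₗ[k] G.B₂
  φB₃ : F.B₃ ≃ₗ[k] G.B₃
  φA₁ : F.A₁ ≃ₗ[k] G.A₁
  φA₂ : F.A₂ ≃ₗ[k] G.A₂
  comm₁₁ : ∀ b, G.ρ₁₁ (φB₁ b) = φA₁ (F.ρ₁₁ b)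
  comm₂₂ : ∀ b, G.ρ₂₂ (φB₂ b) = φA₂ (F.ρ₂₂ b)
  comm₃₁ : ∀ b, G.ρ₃₁ (φB₃ b) = φA₁ (F.ρ₃₁ b)
  comm₃₂ : ∀ b, G.ρ₃₂ (φB₃ b) = φA₂ (F.ρ₃₂ b)

/-- The direct sum of two diagrams. -/
def sum (F G : KDiagram k) : KDiagram k where
  B₁ := ModuleCat.of k (F.B₁ × G.B₁)
  B₂ := ModuleCat.of k (F.B₂ × G.B₂)
  B₃ := ModuleCat.of k (F.B₃ × G.B₃)
  A₁ := ModuleCat.of k (F.A₁ × G.A₁)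
  A₂ := ModuleCat.of k (F.A₂ × G.A₂)
  ρ₁₁ := F.ρ₁₁.prodMap G.ρ₁₁
  ρ₂₂ := F.ρ₂₂.prodMap G.ρ₂₂
  ρ₃₁ := F.ρ₃₁.prodMap G.ρ₃₁
  ρ₃₂ := F.ρ₃₂.prodMap G.ρ₃₂

/-- The direct sum of a family of diagrams. -/
abbrev directSum {S : Type} (F : S → KDiagram k) : KDiagram k where
  B₁ := ModuleCat.of k (DirectSum S fun s => (F s).B₁)
  B₂ := ModuleCat.of k (DirectSum S fun s => (F s).B₂)
  B₃ := ModuleCat.of k (DirectSum S fun s => (F s).B₃)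
  A₁ := ModuleCat.of k (DirectSum S fun s => (F s).A₁)
  A₂ := ModuleCat.of k (DirectSum S fun s => (F s).A₂)
  ρ₁₁ := DirectSum.lmap fun s => (F s).ρ₁₁
  ρ₂₂ := DirectSum.lmap fun s => (F s).ρ₂₂
  ρ₃₁ := DirectSum.lmap fun s => (F s).ρ₃₁
  ρ₃₂ := DirectSum.lmap fun s => (F s).ρ₃₂

lemma diff_lof {S : Type} [DecidableEq S] (F : S → KDiagram k) (s : S)
    (b : (F s).B₁ × (F s).B₂ × (F s).B₃) :
    (directSum F).diff (DirectSum.lof k S (fun s => (F s).B₁) s b.1,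
        DirectSum.lof k S (fun s => (F s).B₂) s b.2.1,
        DirectSum.lof k S (fun s => (F s).B₃) s b.2.2) =
      (DirectSum.lof k S (fun s => (F s).A₁) s ((F s).diff b).1,
        DirectSum.lof k S (fun s => (F s).A₂) s ((F s).diff b).2) := by
  refine Prod.ext ?_ ?_
  · change DirectSum.lmap _ _ - DirectSum.lmap _ _ = _
    rw [DirectSum.lmap_lof, DirectSum.lmap_lof, ← map_sub]
    rfl
  · change DirectSum.lmap _ _ - DirectSum.lmap _ _ = _
    rw [DirectSum.lmap_lof, DirectSum.lmap_lof, ← map_sub]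
    rfl

lemma iso_equivalence : Equivalence fun F G : KDiagram k => Nonempty (Iso F G) where
  refl F := ⟨⟨.refl k _, .refl k _, .refl k _, .refl k _, .refl k _,
    fun _ => rfl, fun _ => rfl, fun _ => rfl, fun _ => rfl⟩⟩
  symm := fun {F G} ⟨e⟩ => ⟨⟨e.φB₁.symm, e.φB₂.symm, e.φB₃.symm, e.φA₁.symm, e.φA₂.symm,
    fun b => by rw [LinearEquiv.eq_symm_apply, ← e.comm₁₁, LinearEquiv.apply_symm_apply],
    fun b => by rw [LinearEquiv.eq_symm_apply, ← e.comm₂₂, LinearEquiv.apply_symm_apply],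
    fun b => by rw [LinearEquiv.eq_symm_apply, ← e.comm₃₁, LinearEquiv.apply_symm_apply],
    fun b => by rw [LinearEquiv.eq_symm_apply, ← e.comm₃₂, LinearEquiv.apply_symm_apply]⟩⟩
  trans := fun ⟨e⟩ ⟨e'⟩ => ⟨⟨e.φB₁.trans e'.φB₁, e.φB₂.trans e'.φB₂, e.φB₃.trans e'.φB₃,
    e.φA₁.trans e'.φA₁, e.φA₂.trans e'.φA₂,
    fun b => by simp [e.comm₁₁, e'.comm₁₁], fun b => by simp [e.comm₂₂, e'.comm₂₂],
    fun b => by simp [e.comm₃₁, e'.comm₃₁], fun b => by simp [e.comm₃₂, e'.comm₃₂]⟩⟩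

/-- Direct sum of isomorphisms. -/
def Iso.sumCongr {F F' G G' : KDiagram k} (e : Iso F F') (e' : Iso G G') :
    Iso (F.sum G) (F'.sum G') where
  φB₁ := e.φB₁.prodCongr e'.φB₁
  φB₂ := e.φB₂.prodCongr e'.φB₂
  φB₃ := e.φB₃.prodCongr e'.φB₃
  φA₁ := e.φA₁.prodCongr e'.φA₁
  φA₂ := e.φA₂.prodCongr e'.φA₂
  comm₁₁ b := Prod.ext (e.comm₁₁ b.1) (e'.comm₁₁ b.2)
  comm₂₂ b := Prod.ext (e.comm₂₂ b.1) (e'.comm₂₂ b.2)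
  comm₃₁ b := Prod.ext (e.comm₃₁ b.1) (e'.comm₃₁ b.2)
  comm₃₂ b := Prod.ext (e.comm₃₂ b.1) (e'.comm₃₂ b.2)

/-- Commutativity of the direct sum. -/
def Iso.sumComm (F G : KDiagram k) : Iso (F.sum G) (G.sum F) where
  φB₁ := LinearEquiv.prodComm k _ _
  φB₂ := LinearEquiv.prodComm k _ _
  φB₃ := LinearEquiv.prodComm k _ _
  φA₁ := LinearEquiv.prodComm k _ _
  φA₂ := LinearEquiv.prodComm k _ _
  comm₁₁ _ := rfl
  comm₂₂ _ := rfl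
  comm₃₁ _ := rfl
  comm₃₂ _ := rfl

/-- Associativity of the direct sum. -/
def Iso.sumAssoc (F G E : KDiagram k) : Iso ((F.sum G).sum E) (F.sum (G.sum E)) where
  φB₁ := LinearEquiv.prodAssoc k _ _ _
  φB₂ := LinearEquiv.prodAssoc k _ _ _
  φB₃ := LinearEquiv.prodAssoc k _ _ _
  φA₁ := LinearEquiv.prodAssoc k _ _ _
  φA₂ := LinearEquiv.prodAssoc k _ _ _
  comm₁₁ _ := rfl
  comm₂₂ _ := rfl
  comm₃₁ _ := rfl
  comm₃₂ _ := rfl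

lemma Iso.diff_comm {F G : KDiagram k} (e : Iso F G) (x : F.B₁ × F.B₂ × F.B₃) :
    G.diff (e.φB₁.prodCongr (e.φB₂.prodCongr e.φB₃) x) =
      e.φA₁.prodCongr e.φA₂ (F.diff x) := by
  simp [diff, e.comm₁₁, e.comm₂₂, e.comm₃₁, e.comm₃₂]

/-- Isomorphic diagrams have isomorphic `H⁰`. -/
noncomputable def Iso.h0 {F G : KDiagram k} (e : Iso F G) : F.H0 ≃ₗ[k] G.H0 :=
  (e.φB₁.prodCongr (e.φB₂.prodCongr e.φB₃)).ofSubmodules F.H0 G.H0 (by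
    ext y
    constructor
    · rintro ⟨x, hx, rfl⟩
      have hx' : F.diff x = 0 := hx
      exact (e.diff_comm x).trans (by rw [hx', map_zero])
    · intro hy
      refine ⟨(e.φB₁.prodCongr (e.φB₂.prodCongr e.φB₃)).symm y, ?_,
        LinearEquiv.apply_symm_apply _ y⟩
      have h := e.diff_comm ((e.φB₁.prodCongr (e.φB₂.prodCongr e.φB₃)).symm y)
      rw [LinearEquiv.apply_symm_apply, show G.diff y = 0 from hy] at h
      exact (LinearEquiv.map_eq_zero_iff _).1 h.symm)

/-- Isomorphic diagrams have isomorphic `H¹`. -/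
noncomputable def Iso.h1 {F G : KDiagram k} (e : Iso F G) : F.H1 ≃ₗ[k] G.H1 :=
  Submodule.Quotient.equiv _ _ (e.φA₁.prodCongr e.φA₂) (by
    ext y
    constructor
    · rintro ⟨_, ⟨x, rfl⟩, rfl⟩
      exact ⟨_, e.diff_comm x⟩
    · rintro ⟨x, rfl⟩
      refine ⟨_, ⟨(e.φB₁.prodCongr (e.φB₂.prodCongr e.φB₃)).symm x, rfl⟩, ?_⟩
      have h := e.diff_comm ((e.φB₁.prodCongr (e.φB₂.prodCongr e.φB₃)).symm x)
      rw [LinearEquiv.apply_symm_apply] at h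
      exact h.symm)

/-- `H⁰(F ⊕ G) ≃ H⁰(F) ⊕ H⁰(G)`. -/
def h0Sum (F G : KDiagram k) : (F.sum G).H0 ≃ₗ[k] F.H0 × G.H0 where
  toFun x := (⟨(x.1.1.1, x.1.2.1.1, x.1.2.2.1), by
      have h := x.2
      exact Prod.ext (congrArg (fun z => z.1.1) h) (congrArg (fun z => z.2.1) h)⟩,
    ⟨(x.1.1.2, x.1.2.1.2, x.1.2.2.2), by
      have h := x.2
      exact Prod.ext (congrArg (fun z => z.1.2) h) (congrArg (fun z => z.2.2) h)⟩)
  map_add' _ _ := rfl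
  map_smul' _ _ := rfl
  invFun y := ⟨((y.1.1.1, y.2.1.1), (y.1.1.2.1, y.2.1.2.1), (y.1.1.2.2, y.2.1.2.2)), by
    have h := y.1.2
    have h' := y.2.2
    exact Prod.ext
      (Prod.ext (congrArg (fun z => z.1) h) (congrArg (fun z => z.1) h'))
      (Prod.ext (congrArg (fun z => z.2) h) (congrArg (fun z => z.2) h'))⟩
  left_inv _ := rfl
  right_inv _ := rfl

/-- `H¹(F ⊕ G) ≃ H¹(F) ⊕ H¹(G)`. -/
noncomputable def h1Sum (F G : KDiagram k) : (F.sum G).H1 ≃ₗ[k] F.H1 × G.H1 :=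
  LinearEquiv.ofBijective
    (Submodule.liftQ (LinearMap.range (F.sum G).diff)
      (((LinearMap.range F.diff).mkQ.prodMap (LinearMap.range G.diff).mkQ).comp
        (LinearEquiv.prodProdProdComm k F.A₁ G.A₁ F.A₂ G.A₂).toLinearMap) (by
          rintro _ ⟨x, rfl⟩
          refine Prod.ext ?_ ?_
          · exact (Submodule.Quotient.mk_eq_zero _).2 ⟨(x.1.1, x.2.1.1, x.2.2.1), rfl⟩
          · exact (Submodule.Quotient.mk_eq_zero _).2 ⟨(x.1.2, x.2.1.2, x.2.2.2), rfl⟩))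
    (by
      constructor
      · rw [injective_iff_map_eq_zero]
        intro z
        induction z using Submodule.Quotient.induction_on with
        | _ a =>
          intro h
          obtain ⟨⟨b₁, b₂, b₃⟩, hb⟩ :=
            (Submodule.Quotient.mk_eq_zero _).1 (congrArg Prod.fst h)
          obtain ⟨⟨c₁, c₂, c₃⟩, hc⟩ :=
            (Submodule.Quotient.mk_eq_zero _).1 (congrArg Prod.snd h)
          refine (Submodule.Quotient.mk_eq_zero _).2 ⟨((b₁, c₁), (b₂, c₂), (b₃, c₃)), ?_⟩
          exact Prod.ext
            (Prod.ext (congrArg (fun z => z.1) hb) (congrArg (fun z => z.1) hc))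
            (Prod.ext (congrArg (fun z => z.2) hb) (congrArg (fun z => z.2) hc))
      · rintro ⟨x, y⟩
        induction x using Submodule.Quotient.induction_on with
        | _ a =>
          induction y using Submodule.Quotient.induction_on with
          | _ b => exact ⟨Submodule.Quotient.mk ((a.1, b.1), (a.2, b.2)), rfl⟩)

lemma IsFredholm.sum {F G : KDiagram k} (hF : F.IsFredholm) (hG : G.IsFredholm) :
    (F.sum G).IsFredholm := by
  have := hF.finite_H0
  have := hF.finite_H1
  have := hG.finite_H0
  have := hG.finite_H1
  exact ⟨Module.Finite.equiv (h0Sum F G).symm, Module.Finite.equiv (h1Sum F G).symm⟩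

end KDiagram

/-- Fredholm `k`-diagrams: `k`-diagrams with finite Betti numbers. -/
def FredholmDiagram (k : Type u) [Field k] : Type (u + 1) :=
  {F : KDiagram k // F.IsFredholm}

noncomputable instance (k : Type u) [Field k] : HasIsoSum (FredholmDiagram k) where
  Iso F G := Nonempty (KDiagram.Iso F.1 G.1)
  sum F G := ⟨F.1.sum G.1, F.2.sum G.2⟩
  iso_equivalence := ⟨fun F => KDiagram.iso_equivalence.refl F.1,
    fun h => KDiagram.iso_equivalence.symm h, fun h h' => KDiagram.iso_equivalence.trans h h'⟩
  sum_congr := fun ⟨e⟩ ⟨e'⟩ => ⟨e.sumCongr e'⟩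
  sum_comm F G := ⟨KDiagram.Iso.sumComm F.1 G.1⟩
  sum_assoc F G E := ⟨KDiagram.Iso.sumAssoc F.1 G.1 E.1⟩

namespace FredholmDiagram

variable {k : Type u} [Field k]

/-- `H⁰` of a Fredholm diagram, as a finite dimensional vector space. -/
noncomputable def H0 (F : FredholmDiagram k) : FGModuleCat.{u} k :=
  haveI := F.2.finite_H0
  FGModuleCat.of k F.1.H0

/-- `H¹` of a Fredholm diagram, as a finite dimensional vector space. -/
noncomputable def H1 (F : FredholmDiagram k) : FGModuleCat.{u} k :=
  haveI := F.2.finite_H1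
  FGModuleCat.of k F.1.H1

end FredholmDiagram

namespace Virtual

variable {k : Type u} [Field k]

/-- `H⁰` of a class of virtual diagrams, `H⁰ [F₁ ⊖ F₂] = [H⁰ F₁ ⊖ H⁰ F₂]`. -/
noncomputable def H0 : Virtual (FredholmDiagram k) → Virtual (FGModuleCat.{u} k) :=
  Virtual.map FredholmDiagram.H0 (fun _ _ ⟨e⟩ => ⟨e.h0⟩)
    (fun F G => ⟨KDiagram.h0Sum F.1 G.1⟩)

/-- `H¹` of a class of virtual diagrams, `H¹ [F₁ ⊖ F₂] = [H¹ F₁ ⊖ H¹ F₂]`. -/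
noncomputable def H1 : Virtual (FredholmDiagram k) → Virtual (FGModuleCat.{u} k) :=
  Virtual.map FredholmDiagram.H1 (fun _ _ ⟨e⟩ => ⟨e.h1⟩)
    (fun F G => ⟨KDiagram.h1Sum F.1 G.1⟩)

end Virtual

/-! ### The diagrams attached to weights -/

/-- The multiset with multiplicities `W ≥ 0`: the pairs `(a, i)` with `1 ≤ i ≤ W a`. -/
abbrev Multi (W : (Fin 2 → ℤ) → ℤ) : Type :=
  {p : (Fin 2 → ℤ) × ℕ // 1 ≤ p.2 ∧ (p.2 : ℤ) ≤ W p.1}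

section Models

variable (k : Type u) [Field k]

/-- The diagram `M_{W,d}` of `W : ℤ² → ℤ_{≥ 0}` and `d ∈ ℤ²`: its values are
`B_i = k^{⊕ ℤ_{≤ d_i}}`, `A_i = k^{⊕ ℤ}`, `B₃ = k^{⊕ W}`; the maps `ρ_{ii}` are the
inclusions and the maps `ρ_{3i}` are induced by the projections. -/
noncomputable abbrev matchingDiagram (W : (Fin 2 → ℤ) → ℤ) (d : Fin 2 → ℤ) : KDiagram k where
  B₁ := ModuleCat.of k ({x : ℤ // x ≤ d 0} →₀ k)
  B₂ := ModuleCat.of k ({x : ℤ // x ≤ d 1} →₀ k)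
  B₃ := ModuleCat.of k (Multi W →₀ k)
  A₁ := ModuleCat.of k (ℤ →₀ k)
  A₂ := ModuleCat.of k (ℤ →₀ k)
  ρ₁₁ := Finsupp.lmapDomain k k Subtype.val
  ρ₂₂ := Finsupp.lmapDomain k k Subtype.val
  ρ₃₁ := Finsupp.lmapDomain k k fun p => p.1.1 0
  ρ₃₂ := Finsupp.lmapDomain k k fun p => p.1.1 1

/-- The indicator diagram `I_{d ≥ a}`: its values at `B₃, A₁, A₂` are `k`, its value at `B_i` is
`k` if `a_i ≤ d_i` and `0` otherwise, and its maps are identities and inclusions. -/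
noncomputable abbrev indicatorDiagram (a d : Fin 2 → ℤ) : KDiagram k where
  B₁ := ModuleCat.of k (if a 0 ≤ d 0 then ⊤ else ⊥ : Submodule k k)
  B₂ := ModuleCat.of k (if a 1 ≤ d 1 then ⊤ else ⊥ : Submodule k k)
  B₃ := ModuleCat.of k k
  A₁ := ModuleCat.of k k
  A₂ := ModuleCat.of k k
  ρ₁₁ := Submodule.subtype _
  ρ₂₂ := Submodule.subtype _
  ρ₃₁ := LinearMap.id
  ρ₃₂ := LinearMap.id

/-- The direct sum of indicator diagrams `I_d^{⊕ W} = ⨁_a (I_{d ≥ a})^{⊕ W a}` for `W ≥ 0`. -/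
noncomputable def indicatorSum (W : (Fin 2 → ℤ) → ℤ) (d : Fin 2 → ℤ) : KDiagram k :=
  KDiagram.directSum fun s : Multi W => indicatorDiagram k s.1.1 d

variable {k}

/-- The kernel of the differential of a sum of indicator diagrams is finite dimensional when
only finitely many summands equal the constant diagram. -/
lemma finite_H0_indicator {S : Type} (a : S → Fin 2 → ℤ) (d : Fin 2 → ℤ)
    (hfin : {s | a s ≤ d}.Finite) :
    Module.Finite k (KDiagram.directSum fun s => indicatorDiagram k (a s) d).H0 := by
  have := hfin.to_subtype
  let F := KDiagram.directSum fun s => indicatorDiagram k (a s) d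
  have key : ∀ x : F.H0, ∀ s, ((x.1.1 s).1 : k) = x.1.2.2 s ∧ ((x.1.2.1 s).1 : k) = x.1.2.2 s := by
    intro x s
    have h : F.diff x.1 = 0 := x.2
    exact ⟨sub_eq_zero.1 (DFunLike.congr_fun (congrArg Prod.fst h) s),
      sub_eq_zero.1 (DFunLike.congr_fun (congrArg Prod.snd h) s)⟩
  let g : F.H0 →ₗ[k] ({s | a s ≤ d} → k) :=
    { toFun := fun x t => x.1.2.2 t.1
      map_add' := fun _ _ => rfl
      map_smul' := fun _ _ => rfl }
  refine Module.Finite.of_injective g ((injective_iff_map_eq_zero g).2 fun x hx => ?_)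
  have h3 : ∀ s, (x.1.2.2 s : k) = 0 := by
    intro s
    by_cases hs : a s ≤ d
    · exact congrFun hx ⟨s, hs⟩
    · rw [Pi.le_def, Fin.forall_fin_two, not_and_or] at hs
      rcases hs with hs | hs
      · rw [← (key x s).1]
        have hm : (if a s 0 ≤ d 0 then ⊤ else ⊥ : Submodule k k) = ⊥ := if_neg hs
        exact (Submodule.mem_bot k).1 (hm.le (x.1.1 s).2)
      · rw [← (key x s).2]
        have hm : (if a s 1 ≤ d 1 then ⊤ else ⊥ : Submodule k k) = ⊥ := if_neg hs
        exact (Submodule.mem_bot k).1 (hm.le (x.1.2.1 s).2)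
  refine Subtype.ext (Prod.ext ?_ (Prod.ext ?_ ?_))
  · exact DFinsupp.ext fun s => Subtype.ext ((key x s).1.trans (h3 s))
  · exact DFinsupp.ext fun s => Subtype.ext ((key x s).2.trans (h3 s))
  · exact DFinsupp.ext fun s => h3 s

/-- The cokernel of the differential of a sum of indicator diagrams is finite dimensional when
only finitely many summands vanish at both `B₁` and `B₂`. -/
lemma finite_H1_indicator {S : Type} (a : S → Fin 2 → ℤ) (d : Fin 2 → ℤ)
    (hfin : {s | d + 1 ≤ a s}.Finite) :
    Module.Finite k (KDiagram.directSum fun s => indicatorDiagram k (a s) d).H1 := by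
  classical
  let F := KDiagram.directSum fun s => indicatorDiagram k (a s) d
  let q := (LinearMap.range F.diff).mkQ
  let e₁ : (s : S) → k →ₗ[k] F.H1 := fun s =>
    q ∘ₗ LinearMap.inl k F.A₁ F.A₂ ∘ₗ DirectSum.lof k S (fun _ => k) s
  let e₂ : (s : S) → k →ₗ[k] F.H1 := fun s =>
    q ∘ₗ LinearMap.inr k F.A₁ F.A₂ ∘ₗ DirectSum.lof k S (fun _ => k) s
  have hq : ∀ s (b : (indicatorDiagram k (a s) d).B₁ × (indicatorDiagram k (a s) d).B₂ ×
      (indicatorDiagram k (a s) d).B₃),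
      e₁ s ((indicatorDiagram k (a s) d).diff b).1 +
        e₂ s ((indicatorDiagram k (a s) d).diff b).2 = 0 := by
    intro s b
    have h := (Submodule.Quotient.mk_eq_zero (LinearMap.range F.diff)).2
      ⟨_, KDiagram.diff_lof (fun s => indicatorDiagram k (a s) d) s b⟩
    refine Eq.trans ?_ h
    refine (map_add q _ _).symm.trans (congrArg q (Prod.ext ?_ ?_))
    · exact add_zero _
    · exact zero_add _
  have h3 : ∀ s x, e₁ s x + e₂ s x = 0 := by
    intro s x
    have h := hq s (0, 0, -x)
    simpa [KDiagram.diff] using h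
  have h1 : ∀ s x, a s 0 ≤ d 0 → e₁ s x = 0 := by
    intro s x hs
    have h := hq s (⟨x, by rw [if_pos hs]; trivial⟩, 0, 0)
    simpa [KDiagram.diff] using h
  have h2 : ∀ s x, a s 1 ≤ d 1 → e₂ s x = 0 := by
    intro s x hs
    have h := hq s (0, ⟨x, by rw [if_pos hs]; trivial⟩, 0)
    simpa [KDiagram.diff] using h
  let V : Submodule k F.H1 := Submodule.span k ((fun s => e₁ s 1) '' {s | d + 1 ≤ a s})
  have hV : ∀ s x, e₁ s x ∈ V := by
    intro s x
    by_cases hs : d + 1 ≤ a s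
    · have : e₁ s x = x • e₁ s 1 := by rw [← map_smul, smul_eq_mul, mul_one]
      rw [this]
      exact V.smul_mem _ (Submodule.subset_span ⟨s, hs, rfl⟩)
    · rw [Pi.le_def, Fin.forall_fin_two, not_and_or] at hs
      have h0 : e₁ s x = 0 := by
        rcases hs with hs | hs
        · exact h1 s x (by simpa [Int.add_one_le_iff] using hs)
        · have := h3 s x
          rwa [h2 s x (by simpa [Int.add_one_le_iff] using hs), add_zero] at this
      rw [h0]
      exact V.zero_mem
  have hV2 : ∀ s x, e₂ s x ∈ V := by
    intro s x
    rw [eq_neg_of_add_eq_zero_right (h3 s x)]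
    exact V.neg_mem (hV s x)
  have hA₁ : ∀ y : F.A₁, q (y, 0) ∈ V := by
    intro y
    induction y using DirectSum.induction_on with
    | zero => exact (map_zero q).symm ▸ V.zero_mem
    | of s x => exact hV s x
    | add x y hx hy =>
      have := V.add_mem hx hy
      rw [← map_add] at this
      simpa using this
  have hA₂ : ∀ y : F.A₂, q (0, y) ∈ V := by
    intro y
    induction y using DirectSum.induction_on with
    | zero => exact (map_zero q).symm ▸ V.zero_mem
    | of s x => exact hV2 s x
    | add x y hx hy =>
      have := V.add_mem hx hy
      rw [← map_add] at this
      simpa using this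
  refine ⟨⟨(hfin.image fun s => e₁ s 1).toFinset, ?_⟩⟩
  rw [Set.Finite.coe_toFinset, eq_top_iff]
  intro z _
  obtain ⟨⟨y₁, y₂⟩, rfl⟩ := Submodule.mkQ_surjective _ z
  have : ((y₁, y₂) : F.A₁ × F.A₂) = (y₁, 0) + (0, y₂) := by simp
  rw [this, map_add]
  exact V.add_mem (hA₁ y₁) (hA₂ y₂)

lemma finite_multi {W : (Fin 2 → ℤ) → ℤ} {T : Set (Fin 2 → ℤ)} (hT : {a ∈ T | W a ≠ 0}.Finite) :
    {s : Multi W | s.1.1 ∈ T}.Finite := by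
  have h : (⋃ a ∈ {a ∈ T | W a ≠ 0}, ({a} : Set (Fin 2 → ℤ)) ×ˢ Set.Iic (W a).toNat).Finite :=
    hT.biUnion fun a _ => (Set.finite_singleton a).prod (Set.finite_Iic _)
  refine Set.Finite.of_finite_image (f := Subtype.val) (h.subset ?_) Subtype.val_injective.injOn
  rintro _ ⟨⟨⟨a, i⟩, h1, h2⟩, ha, rfl⟩
  simp only at h1 h2 ha
  refine Set.mem_biUnion (x := a) ⟨ha, fun h0 => ?_⟩ ⟨rfl, ?_⟩
  · rw [h0] at h2
    omega
  · have h3 : i ≤ (W a).toNat := by omega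
    exact h3

lemma InitiallyZero.finite_le {W : (Fin 2 → ℤ) → ℤ} (h : InitiallyZero W) (d : Fin 2 → ℤ) :
    {a ∈ {a | a ≤ d} | W a ≠ 0}.Finite := by
  obtain ⟨m, hm⟩ := h
  refine (Set.finite_Icc (fun i => m - deg d + d i) d).subset ?_
  rintro a ⟨ha, hW⟩
  have hdeg : m < deg a := by
    by_contra hc
    exact hW (hm a (not_lt.1 hc))
  have h0 := ha 0
  have h1 := ha 1
  rw [deg, Fin.sum_univ_two] at hdeg
  refine ⟨?_, ha⟩
  rw [Pi.le_def, Fin.forall_fin_two, deg, Fin.sum_univ_two]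
  constructor <;> linarith

lemma EventuallyZero.finite_ge {W : (Fin 2 → ℤ) → ℤ} (h : EventuallyZero W) (d : Fin 2 → ℤ) :
    {a ∈ {a | d + 1 ≤ a} | W a ≠ 0}.Finite := by
  obtain ⟨m, hm⟩ := h
  refine (Set.finite_Icc d (fun i => m - deg d + d i)).subset ?_
  rintro a ⟨ha, hW⟩
  have hdeg : deg a < m := by
    by_contra hc
    exact hW (hm a (not_lt.1 hc))
  have h0 := ha 0
  have h1 := ha 1
  simp only [Pi.add_apply, Pi.one_apply] at h0 h1
  rw [deg, Fin.sum_univ_two] at hdeg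
  constructor
  · rw [Pi.le_def, Fin.forall_fin_two]
    constructor <;> linarith
  · rw [Pi.le_def, Fin.forall_fin_two, deg, Fin.sum_univ_two]
    constructor <;> linarith

lemma indicatorSum_isFredholm {W : (Fin 2 → ℤ) → ℤ} (h : InitiallyZero W)
    (h' : EventuallyZero W) (d : Fin 2 → ℤ) : (indicatorSum k W d).IsFredholm :=
  ⟨finite_H0_indicator (fun s : Multi W => s.1.1) d (finite_multi (h.finite_le d)),
    finite_H1_indicator (fun s : Multi W => s.1.1) d (finite_multi (h'.finite_ge d))⟩

lemma InitiallyZero.comp {n : ℕ} {W : (Fin n → ℤ) → ℤ} (h : InitiallyZero W) (g : ℤ → ℤ)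
    (hg : g 0 = 0) : InitiallyZero fun a => g (W a) := by
  obtain ⟨m, hm⟩ := h
  exact ⟨m, fun d hd => (congrArg g (hm d hd)).trans hg⟩

lemma EventuallyZero.comp {n : ℕ} {W : (Fin n → ℤ) → ℤ} (h : EventuallyZero W) (g : ℤ → ℤ)
    (hg : g 0 = 0) : EventuallyZero fun a => g (W a) := by
  obtain ⟨m, hm⟩ := h
  exact ⟨m, fun d hd => (congrArg g (hm d hd)).trans hg⟩

variable (k) in
/-- The class `[M_{W,d}]` attached to a function `W : ℤ² → ℤ` that is initially and eventually
zero, as the formal difference `I_d^{⊕ W⁺} ⊖ I_d^{⊕ W⁻}` with `W⁺ = max(W, 0)` and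
`W⁻ = max(-W, 0)`. -/
noncomputable def weightModel (W : (Fin 2 → ℤ) → ℤ) (h : InitiallyZero W)
    (h' : EventuallyZero W) (d : Fin 2 → ℤ) : Virtual (FredholmDiagram k) :=
  Virtual.mk
    ⟨indicatorSum k (fun a => max (W a) 0) d,
      indicatorSum_isFredholm (h.comp (max · 0) (by simp)) (h'.comp (max · 0) (by simp)) d⟩
    ⟨indicatorSum k (fun a => max (-W a) 0) d,
      indicatorSum_isFredholm (h.comp (fun x => max (-x) 0) (by simp))
        (h'.comp (fun x => max (-x) 0) (by simp)) d⟩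

variable {n : ℕ} {f : (Fin n → ℤ) → ℤ} {C : ℤ}

variable (k) in
/-- The class `[M_{f;i,j,d}] = [M_{W,0}]` for a Riemann function `f : ℤⁿ → ℤ`, where `W` is the
weight of the two-variable restriction `f_{i,j,d}`. -/
noncomputable def restrictionModel (hf : IsRiemannFunction f C) (i j : Fin n) (d : Fin n → ℤ) :
    Virtual (FredholmDiagram k) :=
  weightModel k (weight (restrictTwo f i j d)) (hf.restrictTwo i j d).weight_initiallyZero
    (hf.restrictTwo i j d).weight_eventuallyZero 0

variable (k) in
/-- The class `[M_{f at d}]` for a Riemann function `f : ℤⁿ → ℤ`, `n ≥ 2`: the class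
`[M_{f;i,j,d}]`, taken at the first two coordinates. -/
noncomputable def modelAt (hn : 2 ≤ n) (hf : IsRiemannFunction f C) (d : Fin n → ℤ) :
    Virtual (FredholmDiagram k) :=
  restrictionModel k hf ⟨0, by omega⟩ ⟨1, by omega⟩ d

/-- The class `c` is represented by the formal difference of diagrams `F₁ ⊖ F₂`
(in particular both diagrams are Fredholm). -/
def RepresentedBy (c : Virtual (FredholmDiagram k)) (F₁ F₂ : KDiagram k) : Prop :=
  ∃ (h₁ : F₁.IsFredholm) (h₂ : F₂.IsFredholm), c = Virtual.mk ⟨F₁, h₁⟩ ⟨F₂, h₂⟩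

variable (k) in
/-- The direct sum `⨁_l M_{P l, d}`. -/
noncomputable abbrev matchingSum {S : Type} (P : S → (Fin 2 → ℤ) → ℤ) (d : Fin 2 → ℤ) :
    KDiagram k :=
  KDiagram.directSum fun l => matchingDiagram k (P l) d

/-- The explicit form of the duality isomorphism `H¹(⨁ M_{P l, d})^* ≃ H⁰(⨁ M_{Q l, e})`
induced by `Hom(k_{/B₁,B₂}, k_{/B₁,B₂}) ≃ Hom(k, k)`, `id ↦ id`, on matching indicator summands
`a ↔ d + e + 1 - a`: a functional `w` on `H¹` goes to the global section whose coefficient at the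
basis vector `m` of the `l`-th summand of `B₁` is the value of `w` on the class of the basis vector
`d₁ + e₁ + 1 - m` of the `l`-th summand of `A₁`. -/
def IsCanonicalDuality {S : Type} [DecidableEq S] {P Q : S → (Fin 2 → ℤ) → ℤ} {d e : Fin 2 → ℤ}
    (φ : Module.Dual k (matchingSum k P d).H1 ≃ₗ[k] (matchingSum k Q e).H0) : Prop :=
  ∀ (w : Module.Dual k (matchingSum k P d).H1) (l : S) (m : {x : ℤ // x ≤ e 0}),
    ((φ w).1.1 l : {x : ℤ // x ≤ e 0} →₀ k) m =
      w (Submodule.Quotient.mk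
        (DirectSum.lof k S (fun _ => ℤ →₀ k) l (Finsupp.single (d 0 + e 0 + 1 - m) 1), 0))

/-- The duality isomorphisms `H¹(⨁ M_{P l, d})^* ≃ H⁰(⨁ M_{Q l, e})` (the canonical one) and
`H⁰(⨁ M_{P l, d})^* ≃ H¹(⨁ M_{Q l, e})` (the transpose of the canonical one with the roles of
`P, d` and `Q, e` exchanged) exist. -/
def HaveCanonicalDualities (k : Type u) [Field k] {S : Type} [DecidableEq S]
    (P Q : S → (Fin 2 → ℤ) → ℤ) (d e : Fin 2 → ℤ) : Prop :=
  ∃ (φ : Module.Dual k (matchingSum k P d).H1 ≃ₗ[k] (matchingSum k Q e).H0)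
    (φ' : Module.Dual k (matchingSum k Q e).H1 ≃ₗ[k] (matchingSum k P d).H0)
    (ψ : Module.Dual k (matchingSum k P d).H0 ≃ₗ[k] (matchingSum k Q e).H1),
    IsCanonicalDuality φ ∧ IsCanonicalDuality φ' ∧
      ∀ (u : Module.Dual k (matchingSum k P d).H0) (w : Module.Dual k (matchingSum k Q e).H1),
        w (ψ u) = u (φ' w)

end Models

/-!
All diagrams in sight have monomial bases, so each is a sum of indicator diagrams, of four types
according to whether the values at `B₁` and `B₂` vanish. A type with exactly one nonvanishing value
is acyclic, and adding infinitely many acyclic summands absorbs any number of them; hence the class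
of a virtual monomial diagram is determined by the dimensions of its `H⁰` and `H¹`. For the model of
a weight `W` at `d` these are the sums of `W` over the quadrants `a ≤ d` and `a ≥ d + 1`. For
`W = 𝔪 f` they are `f d` and `f d - deg d - C`, which makes the model independent of the choice of
coordinates, and the reflection `a ↦ L - a` of the dual weight exchanges the two quadrants, which is
duality.

A Riemann function with bounded weight differs from `a ↦ max (deg a + C) 0`, whose weight is a
perfect matching, by a bounded function supported in finitely many degrees. Such a function is a sum
of indicators of subsets of antidiagonals without consecutive points and of their negatives, and the
weight of such an indicator is the difference of two matchings.
-/

section Basis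

open Module

variable {R : Type*} [Semiring R]

lemma prodMap_basis_prod {V V' A A' ι ι' κ κ' : Type*} [AddCommMonoid V] [AddCommMonoid V']
    [AddCommMonoid A] [AddCommMonoid A'] [Module R V] [Module R V'] [Module R A] [Module R A']
    {ρ : V →ₗ[R] A} {ρ' : V' →ₗ[R] A'} {b : Basis ι R V} {b' : Basis ι' R V'} {a : Basis κ R A}
    {a' : Basis κ' R A'} {g : ι → κ} {g' : ι' → κ'} (h : ∀ i, ρ (b i) = a (g i))
    (h' : ∀ i, ρ' (b' i) = a' (g' i)) (i : ι ⊕ ι') :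
    ρ.prodMap ρ' (b.prod b' i) = a.prod a' (Sum.map g g' i) := by
  cases i <;> simp [Basis.prod_apply, h, h']

variable {L : Type*} {V A : L → Type*} [∀ l, AddCommMonoid (V l)]
  [∀ l, AddCommMonoid (A l)] [∀ l, Module R (V l)] [∀ l, Module R (A l)] {ι κ : L → Type*}

lemma dfinsuppBasis_apply [DecidableEq L] (b : ∀ l, Basis (ι l) R (V l)) (i : Σ l, ι l) :
    DFinsupp.basis b i = DFinsupp.single i.1 (b i.1 i.2) := by
  refine (DFinsupp.basis b).apply_eq_iff.2 (Finsupp.ext fun ⟨l, j⟩ => ?_)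
  change (b l).repr (DFinsupp.single i.1 (b i.1 i.2) l) j = _
  obtain ⟨l', i⟩ := i
  by_cases h : l' = l
  · subst h
    simp [Finsupp.single_apply_left sigma_mk_injective]
  · simp [h, Ne.symm h]

lemma lmap_dfinsuppBasis {ρ : ∀ l, V l →ₗ[R] A l} {b : ∀ l, Basis (ι l) R (V l)}
    {a : ∀ l, Basis (κ l) R (A l)} {g : ∀ l, ι l → κ l}
    (h : ∀ l i, ρ l (b l i) = a l (g l i)) (i : Σ l, ι l) :
    DirectSum.lmap ρ (DFinsupp.basis b i) = DFinsupp.basis a (Sigma.map id g i) := by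
  classical
  rw [dfinsuppBasis_apply, dfinsuppBasis_apply]
  exact (DirectSum.lmap_lof ρ i.1 _).trans (congrArg _ (h i.1 i.2))

end Basis

/-- The disjoint union of two subtypes is a subtype of the disjoint union. -/
def sumSubtypeEquiv {S S' : Type*} {p : S → Prop} {q : S' → Prop} :
    {s // p s} ⊕ {s // q s} ≃ {s // Sum.elim p q s} :=
  (Equiv.subtypeSum (p := Sum.elim p q)).symm

/-- A dependent sum of subtypes is a subtype of the dependent sum. -/
def sigmaSubtypeEquiv {L : Type*} {S : L → Type*} {p : ∀ l, S l → Prop} :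
    (Σ l, {s // p l s}) ≃ {s : Σ l, S l // p s.1 s.2} where
  toFun s := ⟨⟨s.1, s.2.1⟩, s.2.2⟩
  invFun s := ⟨s.1.1, s.1.2, s.2⟩
  left_inv _ := rfl
  right_inv _ := rfl

namespace KDiagram

variable {k : Type u} [Field k]

/-- A monomial basis of a diagram `F`, of shape `p₁, p₂ : S → Prop`: bases of the values of `F` at
`B₃`, `A₁`, `A₂` indexed by `S`, and of those at `B₁`, `B₂` indexed by the subsets `p₁`, `p₂` of
`S`, matched by the maps of `F`. It splits `F` into indicator diagrams, one for each `s : S`. -/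
structure MonomialBasis (F : KDiagram k) {S : Type*} (p₁ p₂ : S → Prop) where
  b₁ : Module.Basis {s // p₁ s} k F.B₁
  b₂ : Module.Basis {s // p₂ s} k F.B₂
  b₃ : Module.Basis S k F.B₃
  a₁ : Module.Basis S k F.A₁
  a₂ : Module.Basis S k F.A₂
  ρ₁₁_apply : ∀ s, F.ρ₁₁ (b₁ s) = a₁ s
  ρ₂₂_apply : ∀ s, F.ρ₂₂ (b₂ s) = a₂ s
  ρ₃₁_apply : ∀ s, F.ρ₃₁ (b₃ s) = a₁ s
  ρ₃₂_apply : ∀ s, F.ρ₃₂ (b₃ s) = a₂ s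

namespace MonomialBasis

variable {F G : KDiagram k} {S S' : Type*} {p₁ p₂ : S → Prop} {q₁ q₂ : S' → Prop}

/-- Diagrams with monomial bases of the same shape are isomorphic. -/
noncomputable def iso (M : F.MonomialBasis p₁ p₂) (N : G.MonomialBasis q₁ q₂) (e : S ≃ S')
    (h₁ : ∀ s, p₁ s ↔ q₁ (e s)) (h₂ : ∀ s, p₂ s ↔ q₂ (e s)) : Iso F G where
  φB₁ := M.b₁.equiv N.b₁ (e.subtypeEquiv h₁)
  φB₂ := M.b₂.equiv N.b₂ (e.subtypeEquiv h₂)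
  φB₃ := M.b₃.equiv N.b₃ e
  φA₁ := M.a₁.equiv N.a₁ e
  φA₂ := M.a₂.equiv N.a₂ e
  comm₁₁ := LinearMap.congr_fun (f := G.ρ₁₁ ∘ₗ (M.b₁.equiv N.b₁ _).toLinearMap)
    (g := (M.a₁.equiv N.a₁ e).toLinearMap ∘ₗ F.ρ₁₁) <|
    M.b₁.ext fun s => by simp [M.ρ₁₁_apply, N.ρ₁₁_apply]
  comm₂₂ := LinearMap.congr_fun (f := G.ρ₂₂ ∘ₗ (M.b₂.equiv N.b₂ _).toLinearMap)
    (g := (M.a₂.equiv N.a₂ e).toLinearMap ∘ₗ F.ρ₂₂) <|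
    M.b₂.ext fun s => by simp [M.ρ₂₂_apply, N.ρ₂₂_apply]
  comm₃₁ := LinearMap.congr_fun (f := G.ρ₃₁ ∘ₗ (M.b₃.equiv N.b₃ e).toLinearMap)
    (g := (M.a₁.equiv N.a₁ e).toLinearMap ∘ₗ F.ρ₃₁) <|
    M.b₃.ext fun s => by simp [M.ρ₃₁_apply, N.ρ₃₁_apply]
  comm₃₂ := LinearMap.congr_fun (f := G.ρ₃₂ ∘ₗ (M.b₃.equiv N.b₃ e).toLinearMap)
    (g := (M.a₂.equiv N.a₂ e).toLinearMap ∘ₗ F.ρ₃₂) <|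
    M.b₃.ext fun s => by simp [M.ρ₃₂_apply, N.ρ₃₂_apply]

/-- The monomial basis obtained by relabelling the index set. -/
noncomputable def reindex (M : F.MonomialBasis p₁ p₂) (e : S ≃ S') (h₁ : ∀ s, p₁ s ↔ q₁ (e s))
    (h₂ : ∀ s, p₂ s ↔ q₂ (e s)) : F.MonomialBasis q₁ q₂ where
  b₁ := M.b₁.reindex (e.subtypeEquiv h₁)
  b₂ := M.b₂.reindex (e.subtypeEquiv h₂)
  b₃ := M.b₃.reindex e
  a₁ := M.a₁.reindex e
  a₂ := M.a₂.reindex e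
  ρ₁₁_apply s := by simp [M.ρ₁₁_apply]
  ρ₂₂_apply s := by simp [M.ρ₂₂_apply]
  ρ₃₁_apply s := by simp [M.ρ₃₁_apply]
  ρ₃₂_apply s := by simp [M.ρ₃₂_apply]

/-- The monomial basis of a direct sum of two diagrams. -/
noncomputable def sum (M : F.MonomialBasis p₁ p₂) (N : G.MonomialBasis q₁ q₂) :
    (F.sum G).MonomialBasis (Sum.elim p₁ q₁) (Sum.elim p₂ q₂) where
  b₁ := (M.b₁.prod N.b₁).reindex sumSubtypeEquiv
  b₂ := (M.b₂.prod N.b₂).reindex sumSubtypeEquiv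
  b₃ := M.b₃.prod N.b₃
  a₁ := M.a₁.prod N.a₁
  a₂ := M.a₂.prod N.a₂
  ρ₁₁_apply := by
    rintro ⟨s | s, hs⟩ <;>
      exact (congrArg _ (Module.Basis.reindex_apply _ _ _)).trans
        (prodMap_basis_prod M.ρ₁₁_apply N.ρ₁₁_apply _)
  ρ₂₂_apply := by
    rintro ⟨s | s, hs⟩ <;>
      exact (congrArg _ (Module.Basis.reindex_apply _ _ _)).trans
        (prodMap_basis_prod M.ρ₂₂_apply N.ρ₂₂_apply _)
  ρ₃₁_apply := by
    rintro (s | s) <;>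
      exact prodMap_basis_prod (g := id) (g' := id) M.ρ₃₁_apply N.ρ₃₁_apply _
  ρ₃₂_apply := by
    rintro (s | s) <;>
      exact prodMap_basis_prod (g := id) (g' := id) M.ρ₃₂_apply N.ρ₃₂_apply _

/-- The monomial basis of a direct sum of diagrams. -/
noncomputable def directSum {L : Type} {F : L → KDiagram k} {S : L → Type*}
    {p₁ p₂ : ∀ l, S l → Prop} (M : ∀ l, (F l).MonomialBasis (p₁ l) (p₂ l)) :
    (KDiagram.directSum F).MonomialBasis (fun s : Σ l, S l => p₁ s.1 s.2)
      (fun s : Σ l, S l => p₂ s.1 s.2) where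
  b₁ := (DFinsupp.basis fun l => (M l).b₁).reindex sigmaSubtypeEquiv
  b₂ := (DFinsupp.basis fun l => (M l).b₂).reindex sigmaSubtypeEquiv
  b₃ := DFinsupp.basis fun l => (M l).b₃
  a₁ := DFinsupp.basis fun l => (M l).a₁
  a₂ := DFinsupp.basis fun l => (M l).a₂
  ρ₁₁_apply s := by
    rw [Module.Basis.reindex_apply]
    exact lmap_dfinsuppBasis (fun l => (M l).ρ₁₁_apply) _
  ρ₂₂_apply s := by
    rw [Module.Basis.reindex_apply]
    exact lmap_dfinsuppBasis (fun l => (M l).ρ₂₂_apply) _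
  ρ₃₁_apply := lmap_dfinsuppBasis (g := fun _ => id) fun l => (M l).ρ₃₁_apply
  ρ₃₂_apply := lmap_dfinsuppBasis (g := fun _ => id) fun l => (M l).ρ₃₂_apply

end MonomialBasis

section Models

lemma exists_basis_ite (p : Prop) [Decidable p] :
    ∃ b : Module.Basis {_s : Unit // p} k (if p then ⊤ else ⊥ : Submodule k k),
      ∀ s, (b s : k) = 1 := by
  by_cases hp : p
  · have : Unique {_s : Unit // p} := ⟨⟨⟨(), hp⟩⟩, fun _ => rfl⟩
    exact ⟨(Module.Basis.singleton _ k).map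
      (Submodule.topEquiv.symm.trans (LinearEquiv.ofEq _ _ (if_pos hp).symm)), fun s => by simp⟩
  · have : IsEmpty {_s : Unit // p} := ⟨fun s => hp s.2⟩
    have : Subsingleton (if p then ⊤ else ⊥ : Submodule k k) := by
      rw [if_neg hp]
      infer_instance
    exact ⟨Module.Basis.empty _, isEmptyElim⟩

variable {W : (Fin 2 → ℤ) → ℤ} (a d : Fin 2 → ℤ)

variable (k) in
lemma nonempty_monomialBasis_indicatorDiagram : Nonempty <|
    (indicatorDiagram k a d).MonomialBasis (fun _ : Unit => a 0 ≤ d 0) fun _ => a 1 ≤ d 1 := by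
  obtain ⟨b₁, h₁⟩ := exists_basis_ite (k := k) (a 0 ≤ d 0)
  obtain ⟨b₂, h₂⟩ := exists_basis_ite (k := k) (a 1 ≤ d 1)
  exact ⟨⟨b₁, b₂, .singleton Unit k, .singleton Unit k, .singleton Unit k,
    fun s => by simpa using h₁ s, fun s => by simpa using h₂ s, fun _ => rfl, fun _ => rfl⟩⟩

variable (k W) in
/-- The monomial basis of `I_d^{⊕ W}`. -/
noncomputable def indicatorSumBasis :
    (indicatorSum k W d).MonomialBasis (fun s : Multi W => s.1.1 0 ≤ d 0) (·.1.1 1 ≤ d 1) :=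
  (MonomialBasis.directSum fun s : Multi W =>
    (nonempty_monomialBasis_indicatorDiagram k s.1.1 d).some).reindex
      (Equiv.sigmaUnique (Multi W) fun _ => Unit) (fun _ => Iff.rfl) fun _ => Iff.rfl

end Models

end KDiagram

lemma IsPerfectMatching.bijective_multi_apply {W : (Fin 2 → ℤ) → ℤ} (hW : IsPerfectMatching W)
    (i : Fin 2) : Function.Bijective fun s : Multi W => s.1.1 i := by
  obtain ⟨-, -, π, hπ⟩ := hW
  have mem (s : Multi W) : s.1.1 1 = π (s.1.1 0) ∧ s.1.2 = 1 := by
    obtain ⟨⟨a, j⟩, hj, hW⟩ := s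
    rw [hπ] at hW
    split_ifs at hW with h
    exacts [⟨h, by norm_cast at hW; exact hW.antisymm hj⟩, by omega]
  have point (x : ℤ) : 1 ≤ 1 ∧ ((1 : ℕ) : ℤ) ≤ W ![x, π x] := by simp [hπ]
  refine ⟨fun s t h => Subtype.ext (Prod.ext ?_ ((mem s).2.trans (mem t).2.symm)), fun x => ?_⟩
  · have h₀ : s.1.1 0 = t.1.1 0 := by
      fin_cases i
      exacts [h, π.injective (by rw [← (mem s).1, ← (mem t).1]; exact h)]
    exact funext <| Fin.forall_fin_two.2 ⟨h₀, by rw [(mem s).1, (mem t).1, h₀]⟩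
  · fin_cases i
    exacts [⟨⟨(![x, π x], 1), point x⟩, rfl⟩,
      ⟨⟨(![π.symm x, π (π.symm x)], 1), point _⟩, π.apply_symm_apply x⟩]

/-- The points of a perfect matching, parametrised by their `i`-th coordinates. -/
noncomputable def IsPerfectMatching.multiEquiv {W : (Fin 2 → ℤ) → ℤ} (hW : IsPerfectMatching W)
    (i : Fin 2) : Multi W ≃ ℤ :=
  .ofBijective _ (hW.bijective_multi_apply i)

namespace KDiagram

variable {k : Type u} [Field k]

variable (k) in
/-- The monomial basis of `M_{W,d}` for a perfect matching `W`. -/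
noncomputable def matchingBasis {W : (Fin 2 → ℤ) → ℤ} (hW : IsPerfectMatching W)
    (d : Fin 2 → ℤ) :
    (matchingDiagram k W d).MonomialBasis (fun s : Multi W => s.1.1 0 ≤ d 0) (·.1.1 1 ≤ d 1) where
  b₁ := Finsupp.basisSingleOne.reindex ((hW.multiEquiv 0).subtypeEquiv fun _ => Iff.rfl).symm
  b₂ := Finsupp.basisSingleOne.reindex ((hW.multiEquiv 1).subtypeEquiv fun _ => Iff.rfl).symm
  b₃ := Finsupp.basisSingleOne
  a₁ := Finsupp.basisSingleOne.reindex (hW.multiEquiv 0).symm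
  a₂ := Finsupp.basisSingleOne.reindex (hW.multiEquiv 1).symm
  ρ₁₁_apply s := (congrArg _ (Module.Basis.reindex_apply ..)).trans <| by
    rw [Module.Basis.reindex_apply, Finsupp.coe_basisSingleOne, Finsupp.lmapDomain_apply,
      Finsupp.mapDomain_single]
    rfl
  ρ₂₂_apply s := (congrArg _ (Module.Basis.reindex_apply ..)).trans <| by
    rw [Module.Basis.reindex_apply, Finsupp.coe_basisSingleOne, Finsupp.lmapDomain_apply,
      Finsupp.mapDomain_single]
    rfl
  ρ₃₁_apply s := by simp [IsPerfectMatching.multiEquiv]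
  ρ₃₂_apply s := by simp [IsPerfectMatching.multiEquiv]

end KDiagram

namespace KDiagram.MonomialBasis

open Module

variable {k : Type u} [Field k] {F G : KDiagram k} {S S' : Type*} {p₁ p₂ : S → Prop}
  {q₁ q₂ : S' → Prop} (M : F.MonomialBasis p₁ p₂) (N : G.MonomialBasis q₁ q₂)

lemma repr_ρ₁₁ (x : F.B₁) : M.a₁.repr (F.ρ₁₁ x) = (M.b₁.repr x).mapDomain Subtype.val :=
  LinearMap.congr_fun (f := M.a₁.repr.toLinearMap ∘ₗ F.ρ₁₁)
    (g := Finsupp.lmapDomain k k Subtype.val ∘ₗ M.b₁.repr.toLinearMap)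
    (M.b₁.ext fun s => by simp [M.ρ₁₁_apply]) x

lemma repr_ρ₂₂ (x : F.B₂) : M.a₂.repr (F.ρ₂₂ x) = (M.b₂.repr x).mapDomain Subtype.val :=
  LinearMap.congr_fun (f := M.a₂.repr.toLinearMap ∘ₗ F.ρ₂₂)
    (g := Finsupp.lmapDomain k k Subtype.val ∘ₗ M.b₂.repr.toLinearMap)
    (M.b₂.ext fun s => by simp [M.ρ₂₂_apply]) x

lemma repr_ρ₃₁ (x : F.B₃) : M.a₁.repr (F.ρ₃₁ x) = M.b₃.repr x :=
  LinearMap.congr_fun (f := M.a₁.repr.toLinearMap ∘ₗ F.ρ₃₁) (g := M.b₃.repr.toLinearMap)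
    (M.b₃.ext fun s => by simp [M.ρ₃₁_apply]) x

lemma repr_ρ₃₂ (x : F.B₃) : M.a₂.repr (F.ρ₃₂ x) = M.b₃.repr x :=
  LinearMap.congr_fun (f := M.a₂.repr.toLinearMap ∘ₗ F.ρ₃₂) (g := M.b₃.repr.toLinearMap)
    (M.b₃.ext fun s => by simp [M.ρ₃₂_apply]) x

lemma mapDomain_repr_b₁ (x : F.H0) :
    (M.b₁.repr x.1.1).mapDomain Subtype.val = M.b₃.repr x.1.2.2 := by
  rw [← M.repr_ρ₁₁, ← M.repr_ρ₃₁, sub_eq_zero.1 (congrArg Prod.fst (LinearMap.mem_ker.1 x.2))]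

lemma mapDomain_repr_b₂ (x : F.H0) :
    (M.b₂.repr x.1.2.1).mapDomain Subtype.val = M.b₃.repr x.1.2.2 := by
  rw [← M.repr_ρ₂₂, ← M.repr_ρ₃₂, sub_eq_zero.1 (congrArg Prod.snd (LinearMap.mem_ker.1 x.2))]

lemma repr_b₁_apply (x : F.H0) (s : {s // p₁ s}) :
    M.b₁.repr x.1.1 s = M.b₃.repr x.1.2.2 s := by
  rw [← M.mapDomain_repr_b₁, Finsupp.mapDomain_apply Subtype.val_injective]

lemma repr_b₂_apply (x : F.H0) (s : {s // p₂ s}) :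
    M.b₂.repr x.1.2.1 s = M.b₃.repr x.1.2.2 s := by
  rw [← M.mapDomain_repr_b₂, Finsupp.mapDomain_apply Subtype.val_injective]

lemma repr_b₃_eq_zero (x : F.H0) {s : S} (hs : ¬(p₁ s ∧ p₂ s)) : M.b₃.repr x.1.2.2 s = 0 := by
  by_cases h : p₁ s
  · rw [← M.mapDomain_repr_b₂, Finsupp.mapDomain_of_notMem_range]
    rintro ⟨t, rfl⟩
    exact hs ⟨h, t.2⟩
  · rw [← M.mapDomain_repr_b₁, Finsupp.mapDomain_of_notMem_range]
    rintro ⟨t, rfl⟩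
    exact h t.2

/-- The global section with components `b₁ s`, `b₂ s`, `b₃ s`. -/
noncomputable def cocycle (s : {s // p₁ s ∧ p₂ s}) : F.H0 :=
  ⟨(M.b₁ ⟨s, s.2.1⟩, M.b₂ ⟨s, s.2.2⟩, M.b₃ s), by
    simp [diff, M.ρ₁₁_apply, M.ρ₂₂_apply, M.ρ₃₁_apply, M.ρ₃₂_apply]⟩

variable (F) in
/-- The component at `B₃` of a global section. -/
def projB₃ : F.H0 →ₗ[k] F.B₃ :=
  LinearMap.snd k F.B₂ F.B₃ ∘ₗ LinearMap.snd k F.B₁ _ ∘ₗ F.H0.subtype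

include M in
lemma injective_projB₃ : Function.Injective (projB₃ F) := by
  refine (injective_iff_map_eq_zero _).2 fun x (hx : x.1.2.2 = 0) => ?_
  refine Subtype.ext (Prod.ext ?_ (Prod.ext ?_ hx))
  · exact M.b₁.repr.map_eq_zero_iff.1 (Finsupp.ext fun s => by simp [M.repr_b₁_apply, hx])
  · exact M.b₂.repr.map_eq_zero_iff.1 (Finsupp.ext fun s => by simp [M.repr_b₂_apply, hx])

/-- The basis of `H⁰` indexed by the summands that are constant, i.e. that are nonzero at both
`B₁` and `B₂`. -/
noncomputable def basisH0 : Basis {s // p₁ s ∧ p₂ s} k F.H0 :=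
  .mk (v := M.cocycle)
    (.of_comp (projB₃ F) (M.b₃.linearIndependent.comp _ Subtype.val_injective)) <| by
    intro x _
    have hx : projB₃ F x ∈ Submodule.span k (M.b₃ '' {s | p₁ s ∧ p₂ s}) :=
      M.b₃.mem_span_image.2 fun s hs => by_contra fun h => by
        simp_all [projB₃, M.repr_b₃_eq_zero]
    rw [Set.image_eq_range] at hx
    change projB₃ F x ∈ Submodule.span k (Set.range (projB₃ F ∘ M.cocycle)) at hx
    rw [Set.range_comp, Submodule.span_image] at hx
    obtain ⟨y, hy, hyx⟩ := hx
    exact M.injective_projB₃ hyx ▸ hy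

@[simp]
lemma basisH0_apply (s : {s // p₁ s ∧ p₂ s}) : M.basisH0 s = M.cocycle s :=
  Basis.mk_apply ..

lemma basisH0_repr (x : F.H0) (s : {s // p₁ s ∧ p₂ s}) :
    M.basisH0.repr x s = M.b₃.repr x.1.2.2 s :=
  LinearMap.congr_fun (f := M.basisH0.coord s) (g := M.b₃.coord s ∘ₗ projB₃ F)
    (M.basisH0.ext fun t => by
      rw [Basis.coord_apply, Basis.repr_self, basisH0_apply]
      simp [projB₃, cocycle, Finsupp.single_apply_left Subtype.val_injective]) x

/-- The class of `(a₁ s, 0)`. -/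
noncomputable def classA₁ (s : S) : F.H1 :=
  Submodule.Quotient.mk (M.a₁ s, 0)

variable {M} in
lemma classA₁_eq_neg_mk (s : S) : M.classA₁ s = -Submodule.Quotient.mk (0, M.a₂ s) := by
  rw [classA₁, ← Submodule.Quotient.mk_neg, Submodule.Quotient.eq]
  exact ⟨(0, 0, -M.b₃ s), by simp [diff, M.ρ₃₁_apply, M.ρ₃₂_apply]⟩

lemma classA₁_eq_zero {s : S} (hs : ¬(¬p₁ s ∧ ¬p₂ s)) : M.classA₁ s = 0 := by
  rw [not_and_or, not_not, not_not] at hs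
  rcases hs with h | h
  · rw [classA₁, Submodule.Quotient.mk_eq_zero]
    exact ⟨(M.b₁ ⟨s, h⟩, 0, 0), by simp [diff, M.ρ₁₁_apply]⟩
  · rw [classA₁_eq_neg_mk, neg_eq_zero, Submodule.Quotient.mk_eq_zero]
    exact ⟨(0, M.b₂ ⟨s, h⟩, 0), by simp [diff, M.ρ₂₂_apply]⟩

/-- The coordinates of a class in `H¹` at the summands that vanish at both `B₁` and `B₂`. -/
noncomputable def coordH1 : F.H1 →ₗ[k] {s // ¬p₁ s ∧ ¬p₂ s} →₀ k :=
  Submodule.liftQ _ (Finsupp.lcomapDomain _ Subtype.val_injective ∘ₗ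
    (M.a₁.repr.toLinearMap ∘ₗ .fst k _ _ - M.a₂.repr.toLinearMap ∘ₗ .snd k _ _)) <| by
    rintro _ ⟨b, rfl⟩
    ext ⟨s, h₁, h₂⟩
    have hb₁ : (M.b₁.repr b.1).mapDomain Subtype.val s = 0 :=
      Finsupp.mapDomain_of_notMem_range _ _ fun ⟨t, ht⟩ => h₁ (ht ▸ t.2)
    have hb₂ : (M.b₂.repr b.2.1).mapDomain Subtype.val s = 0 :=
      Finsupp.mapDomain_of_notMem_range _ _ fun ⟨t, ht⟩ => h₂ (ht ▸ t.2)
    simp [diff, M.repr_ρ₁₁, M.repr_ρ₂₂, M.repr_ρ₃₁, M.repr_ρ₃₂, hb₁, hb₂]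

lemma coordH1_classA₁ (s : {s // ¬p₁ s ∧ ¬p₂ s}) :
    M.coordH1 (M.classA₁ s) = Finsupp.single s 1 := by
  ext t
  simp [coordH1, classA₁]

lemma span_classA₁ :
    Submodule.span k (Set.range fun s : {s // ¬p₁ s ∧ ¬p₂ s} => M.classA₁ s) = ⊤ := by
  set V := Submodule.span k (Set.range fun s : {s // ¬p₁ s ∧ ¬p₂ s} => M.classA₁ s)
  have mem_A₁ (s : S) : M.classA₁ s ∈ V := by
    by_cases hs : ¬p₁ s ∧ ¬p₂ s
    · exact Submodule.subset_span ⟨⟨s, hs⟩, rfl⟩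
    · exact M.classA₁_eq_zero hs ▸ V.zero_mem
  have top_le : ⊤ ≤ V.comap (LinearMap.range F.diff).mkQ := by
    rw [← (M.a₁.prod M.a₂).span_eq, Submodule.span_le]
    rintro _ ⟨s | s, rfl⟩
    · simpa [Basis.prod_apply] using! mem_A₁ s
    · simpa [Basis.prod_apply, classA₁_eq_neg_mk] using! mem_A₁ s
  refine eq_top_iff.2 fun z _ => ?_
  obtain ⟨y, rfl⟩ := Submodule.mkQ_surjective _ z
  exact top_le (Submodule.mem_top (x := y))

/-- The basis of `H¹` indexed by the summands that vanish at both `B₁` and `B₂`. -/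
noncomputable def basisH1 : Basis {s // ¬p₁ s ∧ ¬p₂ s} k F.H1 :=
  .mk (v := fun s => M.classA₁ s)
    (.of_comp M.coordH1 <| by
      simpa [Function.comp_def, M.coordH1_classA₁] using
        Finsupp.basisSingleOne.linearIndependent)
    M.span_classA₁.ge

@[simp]
lemma basisH1_apply (s : {s // ¬p₁ s ∧ ¬p₂ s}) : M.basisH1 s = M.classA₁ s :=
  Basis.mk_apply ..

section Duality

variable [Finite {s // ¬p₁ s ∧ ¬p₂ s}] (e : S ≃ S') (h₁ : ∀ s, q₁ (e s) ↔ ¬p₁ s)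
  (h₂ : ∀ s, q₂ (e s) ↔ ¬p₂ s)

/-- The duality between diagrams of complementary shapes: an isomorphism `H¹(F)^* ≃ H⁰(G)`
under which the dual basis of `M.basisH1` corresponds to `N.basisH0`. -/
noncomputable def dualH1Equiv : Dual k F.H1 ≃ₗ[k] G.H0 :=
  haveI := Classical.decEq {s // ¬p₁ s ∧ ¬p₂ s}
  M.basisH1.dualBasis.repr.trans
    (N.basisH0.reindex (e.subtypeEquiv fun s => ((h₁ s).and (h₂ s)).symm).symm).repr.symm

lemma repr_b₁_dualH1Equiv (w : Dual k F.H1) (s : S) (hs : q₁ (e s)) :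
    N.b₁.repr (M.dualH1Equiv N e h₁ h₂ w).1.1 ⟨e s, hs⟩ = w (M.classA₁ s) := by
  rw [N.repr_b₁_apply]
  by_cases h : ¬p₁ s ∧ ¬p₂ s
  · have h' : q₁ (e s) ∧ q₂ (e s) := ⟨hs, (h₂ s).2 h.2⟩
    rw [← N.basisH0_repr _ ⟨e s, h'⟩, ← M.basisH1_apply ⟨s, h⟩]
    trans (N.basisH0.reindex (e.subtypeEquiv fun s => ((h₁ s).and (h₂ s)).symm).symm).repr
      (M.dualH1Equiv N e h₁ h₂ w) ⟨s, h⟩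
    · rw [Basis.repr_reindex_apply]
      rfl
    · rw [dualH1Equiv, LinearEquiv.trans_apply, LinearEquiv.apply_symm_apply]
      let := Classical.decEq {s // ¬p₁ s ∧ ¬p₂ s}
      exact M.basisH1.dualBasis_repr w ⟨s, h⟩
  · rw [M.classA₁_eq_zero h, map_zero]
    exact N.repr_b₃_eq_zero _ fun h' => h ⟨(h₁ s).1 h'.1, (h₂ s).1 h'.2⟩

end Duality

end KDiagram.MonomialBasis

section Finiteness

variable {W : (Fin 2 → ℤ) → ℤ}

lemma InitiallyZero.finite_multi_le (h : InitiallyZero W) (d : Fin 2 → ℤ) :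
    Finite {s : Multi W // s.1.1 0 ≤ d 0 ∧ s.1.1 1 ≤ d 1} :=
  ((finite_multi (h.finite_le d)).subset fun _ hs => Fin.forall_fin_two.2 hs).to_subtype

lemma EventuallyZero.finite_multi_not_le (h : EventuallyZero W) (d : Fin 2 → ℤ) :
    Finite {s : Multi W // ¬s.1.1 0 ≤ d 0 ∧ ¬s.1.1 1 ≤ d 1} :=
  ((finite_multi (h.finite_ge d)).subset fun _ hs =>
    Fin.forall_fin_two.2 (hs.imp not_le.1 not_le.1)).to_subtype

end Finiteness

lemma IsPerfectMatching.dualWeight {W : (Fin 2 → ℤ) → ℤ} (h : IsPerfectMatching W)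
    (L : Fin 2 → ℤ) : IsPerfectMatching (dualWeight W L) := by
  obtain ⟨h₀, h₁, π, hπ⟩ := h
  refine ⟨h₁.dualWeight L, h₀.dualWeight L,
    ((Equiv.subLeft (L 0)).trans π).trans (Equiv.subLeft (L 1)), fun a => ?_⟩
  simp only [_root_.dualWeight, hπ, Equiv.trans_apply, Equiv.subLeft_apply, Pi.sub_apply]
  congr 1
  exact propext (by omega)

/-- The bijection `a ↦ L - a` between the multisets of multiplicities `W` and `W*_L`. -/
def multiDualEquiv (W : (Fin 2 → ℤ) → ℤ) (L : Fin 2 → ℤ) : Multi W ≃ Multi (dualWeight W L) :=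
  ((Equiv.subLeft L).prodCongr (.refl ℕ)).subtypeEquiv fun _ => by simp [dualWeight]

namespace KDiagram

variable {k : Type u} [Field k] {S : Type} {P : S → (Fin 2 → ℤ) → ℤ}

variable (k) in
/-- The monomial basis of `⨁ M_{P l, d}` for a family of perfect matchings. -/
noncomputable def matchingSumBasis (hP : ∀ l, IsPerfectMatching (P l)) (d : Fin 2 → ℤ) :
    (matchingSum k P d).MonomialBasis (fun s : Σ l, Multi (P l) => s.2.1.1 0 ≤ d 0)
      (·.2.1.1 1 ≤ d 1) :=
  .directSum fun l => matchingBasis k (hP l) d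

lemma matchingSumBasis_a₁ [DecidableEq S] (hP : ∀ l, IsPerfectMatching (P l)) (d : Fin 2 → ℤ)
    (s : Σ l, Multi (P l)) : (matchingSumBasis k hP d).a₁ s =
      DirectSum.lof k S (fun _ => ℤ →₀ k) s.1 (Finsupp.single (s.2.1.1 0) 1) := by
  cases Subsingleton.elim ‹DecidableEq S› (Classical.decEq S)
  let := Classical.decEq S
  refine (dfinsuppBasis_apply _ s).trans (congrArg (DFinsupp.single s.1) ?_)
  simp [matchingBasis, IsPerfectMatching.multiEquiv]

lemma matchingSumBasis_repr_b₁ (hP : ∀ l, IsPerfectMatching (P l)) {d : Fin 2 → ℤ}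
    (x : (matchingSum k P d).B₁) (s : Σ l, Multi (P l)) (hs : s.2.1.1 0 ≤ d 0) :
    (matchingSumBasis k hP d).b₁.repr x ⟨s, hs⟩ = (x s.1 : {m : ℤ // m ≤ d 0} →₀ k) ⟨_, hs⟩ := by
  rw [matchingSumBasis, MonomialBasis.directSum, Module.Basis.repr_reindex_apply]
  change (matchingBasis k (hP s.1) d).b₁.repr (x s.1) ⟨s.2, hs⟩ = _
  exact Module.Basis.repr_reindex_apply ..

lemma finite_sigma_multi_not_le [Finite S] (hP : ∀ l, IsPerfectMatching (P l)) (d : Fin 2 → ℤ) :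
    Finite {s : Σ l, Multi (P l) // ¬s.2.1.1 0 ≤ d 0 ∧ ¬s.2.1.1 1 ≤ d 1} :=
  have := fun l => (hP l).2.1.finite_multi_not_le d
  .of_equiv (Σ l, {s : Multi (P l) // ¬s.1.1 0 ≤ d 0 ∧ ¬s.1.1 1 ≤ d 1}) sigmaSubtypeEquiv

variable [DecidableEq S]

lemma exists_isCanonicalDuality [Finite S] (hP : ∀ l, IsPerfectMatching (P l))
    {Q : S → (Fin 2 → ℤ) → ℤ} {d e : Fin 2 → ℤ} (hQ : Q = fun l => dualWeight (P l) (d + e + 1)) :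
    ∃ φ : Module.Dual k (matchingSum k P d).H1 ≃ₗ[k] (matchingSum k Q e).H0,
      IsCanonicalDuality φ := by
  subst hQ
  have := finite_sigma_multi_not_le hP d
  let E := Equiv.sigmaCongrRight fun l => multiDualEquiv (P l) (d + e + 1)
  have hE (i) (s : Σ l, Multi (P l)) : (E s).2.1.1 i ≤ e i ↔ ¬s.2.1.1 i ≤ d i := by
    change d i + e i + 1 - s.2.1.1 i ≤ e i ↔ _
    omega
  let M := matchingSumBasis k hP d
  let N := matchingSumBasis k (fun l => (hP l).dualWeight (d + e + 1)) e
  refine ⟨M.dualH1Equiv N E (hE 0) (hE 1), fun w l ⟨m, hm⟩ => ?_⟩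
  obtain ⟨s, hs⟩ := ((hP l).bijective_multi_apply 0).2 (d 0 + e 0 + 1 - m)
  obtain rfl : (E ⟨l, s⟩).2.1.1 0 = m :=
    (congrArg (d 0 + e 0 + 1 - ·) hs).trans (sub_sub_cancel _ _)
  refine (matchingSumBasis_repr_b₁ (fun l => (hP l).dualWeight (d + e + 1)) _ (E ⟨l, s⟩)
    hm).symm.trans <| (M.repr_b₁_dualH1Equiv N E (hE 0) (hE 1) w ⟨l, s⟩ hm).trans (congrArg w ?_)
  rw [← hs, MonomialBasis.classA₁, matchingSumBasis_a₁]

lemma haveCanonicalDualities [Finite S] (hP : ∀ l, IsPerfectMatching (P l)) {d e L : Fin 2 → ℤ}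
    (hL : L = d + e + 1) : HaveCanonicalDualities k P (fun l => dualWeight (P l) L) d e := by
  subst hL
  obtain ⟨φ, hφ⟩ := exists_isCanonicalDuality (k := k) (d := d) (e := e) hP rfl
  obtain ⟨φ', hφ'⟩ := exists_isCanonicalDuality (k := k) (d := e) (e := d) (Q := P)
    (fun l => (hP l).dualWeight (d + e + 1)) (by ext l a; simp [dualWeight, add_comm e d])
  have hQ := fun l => (hP l).dualWeight (d + e + 1)
  have := finite_sigma_multi_not_le hQ e
  have := Module.Finite.of_basis (matchingSumBasis k hQ e).basisH1
  exact ⟨φ, φ', φ'.dualMap.trans (Module.evalEquiv k _).symm, hφ, hφ', fun u w =>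
    Module.apply_evalEquiv_symm_apply _ _ w _⟩

end KDiagram

section Fibers

variable {A A' S S' T γ : Type*}

lemma nonempty_sum_equiv_sum [Countable A] [Countable A'] [Countable T]
    (h : Infinite T ∨ Nonempty (A ≃ A')) : Nonempty (A ⊕ T ≃ A' ⊕ T) := by
  obtain h | ⟨⟨e⟩⟩ := h
  · obtain ⟨_⟩ := nonempty_denumerable (A ⊕ T)
    obtain ⟨_⟩ := nonempty_denumerable (A' ⊕ T)
    exact ⟨Denumerable.equiv₂ _ _⟩
  · exact ⟨e.sumCongr (.refl T)⟩

lemma exists_sum_equiv_sum_of_fibers [Countable S] [Countable S'] [Countable T] {f : S → γ}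
    {f' : S' → γ} {h : T → γ}
    (H : ∀ c, Infinite {t // h t = c} ∨ Nonempty ({s // f s = c} ≃ {s // f' s = c})) :
    ∃ e : S ⊕ T ≃ S' ⊕ T, ∀ x, Sum.elim f' h (e x) = Sum.elim f h x := by
  have fiberEquiv (c : γ) : Nonempty
      ({x // Sum.elim f h x = c} ≃ {x // Sum.elim f' h x = c}) :=
    (nonempty_sum_equiv_sum (H c)).map fun e =>
      (Equiv.subtypeSum (p := (Sum.elim f h · = c))).trans <|
        e.trans (Equiv.subtypeSum (p := (Sum.elim f' h · = c))).symm
  exact ⟨.ofFiberEquiv fun c => (fiberEquiv c).some, Equiv.ofFiberEquiv_map _⟩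

end Fibers

namespace Virtual

open Module

variable {k : Type u} [Field k]

lemma finrank_sum (V W : FGModuleCat.{u} k) :
    finrank k (HasIsoSum.sum V W : FGModuleCat.{u} k) = finrank k V + finrank k W :=
  finrank_prod

/-- The dimension of a virtual vector space. -/
noncomputable def dim : Virtual (FGModuleCat.{u} k) → ℤ :=
  Quotient.lift (fun x => (finrank k x.1 : ℤ) - finrank k x.2) <| by
    rintro ⟨V₁, V₂⟩ ⟨V₁', V₂'⟩ ⟨V₀, ⟨e⟩⟩
    have h := LinearEquiv.finrank_eq e
    simp only [finrank_sum] at h ⊢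
    omega

lemma dim_injective : Function.Injective (dim (k := k)) := by
  rintro ⟨V₁, V₂⟩ ⟨V₁', V₂'⟩ h
  have h : (finrank k V₁ : ℤ) - finrank k V₂ = finrank k V₁' - finrank k V₂' := h
  refine Quotient.sound ⟨V₁, ⟨LinearEquiv.ofFinrankEq _ _ ?_⟩⟩
  simp only [finrank_sum]
  omega

lemma dim_dual (V : Virtual (FGModuleCat.{u} k)) : V.dual.dim = V.dim := by
  obtain ⟨V₁, V₂⟩ := V
  exact congrArg₂ (fun m n : ℕ => (m : ℤ) - n) Subspace.dual_finrank_eq Subspace.dual_finrank_eq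

lemma dim_H0_mk (F₁ F₂ : FredholmDiagram k) :
    (mk F₁ F₂).H0.dim = (finrank k F₁.1.H0 : ℤ) - finrank k F₂.1.H0 :=
  rfl

lemma dim_H1_mk (F₁ F₂ : FredholmDiagram k) :
    (mk F₁ F₂).H1.dim = (finrank k F₁.1.H1 : ℤ) - finrank k F₂.1.H1 :=
  rfl

end Virtual

namespace KDiagram

open Module

variable {k : Type u} [Field k] {F G : KDiagram k}

/-- A diagram is monomial if it has a countable monomial basis, i.e. if it is a countable direct
sum of indicator diagrams. -/
def IsMonomial (F : KDiagram k) : Prop :=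
  ∃ (S : Type) (_ : Countable S) (p₁ p₂ : S → Prop), Nonempty (F.MonomialBasis p₁ p₂)

lemma MonomialBasis.isMonomial {S : Type} [Countable S] {p₁ p₂ : S → Prop}
    (M : F.MonomialBasis p₁ p₂) : F.IsMonomial :=
  ⟨S, ‹_›, p₁, p₂, ⟨M⟩⟩

lemma IsMonomial.sum (hF : F.IsMonomial) (hG : G.IsMonomial) : (F.sum G).IsMonomial := by
  obtain ⟨S, _, p₁, p₂, ⟨M⟩⟩ := hF
  obtain ⟨T, _, q₁, q₂, ⟨N⟩⟩ := hG
  exact (M.sum N).isMonomial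

lemma MonomialBasis.isFredholm {S : Type*} {p₁ p₂ : S → Prop} (M : F.MonomialBasis p₁ p₂)
    [Finite {s // p₁ s ∧ p₂ s}] [Finite {s // ¬p₁ s ∧ ¬p₂ s}] : F.IsFredholm :=
  ⟨.of_basis M.basisH0, .of_basis M.basisH1⟩

variable (k) in
/-- The sum of infinitely many copies of each of the two acyclic indicator diagrams. -/
noncomputable abbrev acyclicSum : KDiagram k :=
  .directSum fun s : ℕ ⊕ ℕ => indicatorDiagram k (s.elim (fun _ => ![0, 1]) fun _ => ![1, 0]) 0

variable (k) in
/-- The monomial basis of the sum of infinitely many copies of each of the two acyclic indicator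
diagrams. -/
noncomputable def acyclicSumBasis :
    (acyclicSum k).MonomialBasis (fun s : ℕ ⊕ ℕ => s.isLeft = true) (·.isRight = true) :=
  (MonomialBasis.directSum fun s : ℕ ⊕ ℕ =>
    (nonempty_monomialBasis_indicatorDiagram k
      (s.elim (fun _ => ![0, 1]) fun _ => ![1, 0]) 0).some).reindex
      (Equiv.sigmaUnique (ℕ ⊕ ℕ) fun _ => Unit) (by rintro ⟨_ | _, _⟩ <;> simp)
      (by rintro ⟨_ | _, _⟩ <;> simp)

lemma isFredholm_acyclicSum : (acyclicSum k).IsFredholm := by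
  have : IsEmpty {s : ℕ ⊕ ℕ // s.isLeft = true ∧ s.isRight = true} := ⟨by simp⟩
  have : IsEmpty {s : ℕ ⊕ ℕ // ¬s.isLeft = true ∧ ¬s.isRight = true} := ⟨by simp⟩
  exact (acyclicSumBasis k).isFredholm

lemma IsFredholm.finrank_H0_sum (hF : F.IsFredholm) (hG : G.IsFredholm) :
    finrank k (F.sum G).H0 = finrank k F.H0 + finrank k G.H0 := by
  have := hF.finite_H0
  have := hG.finite_H0
  rw [(h0Sum F G).finrank_eq, finrank_prod]

lemma IsFredholm.finrank_H1_sum (hF : F.IsFredholm) (hG : G.IsFredholm) :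
    finrank k (F.sum G).H1 = finrank k F.H1 + finrank k G.H1 := by
  have := hF.finite_H1
  have := hG.finite_H1
  rw [(h1Sum F G).finrank_eq, finrank_prod]

lemma IsMonomial.nonempty_iso_sum_acyclicSum (hF : F.IsMonomial) (hG : G.IsMonomial)
    (hF' : F.IsFredholm) (hG' : G.IsFredholm) (h₀ : finrank k F.H0 = finrank k G.H0)
    (h₁ : finrank k F.H1 = finrank k G.H1) :
    Nonempty (Iso (F.sum (acyclicSum k)) (G.sum (acyclicSum k))) := by
  obtain ⟨S, _, p₁, p₂, ⟨M⟩⟩ := hF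
  obtain ⟨T, _, q₁, q₂, ⟨N⟩⟩ := hG
  have := hF'.finite_H0
  have := hF'.finite_H1
  have := hG'.finite_H0
  have := hG'.finite_H1
  have e₀ : {s // p₁ s ∧ p₂ s} ≃ {t // q₁ t ∧ q₂ t} :=
    M.basisH0.indexEquiv ((N.basisH0).map (LinearEquiv.ofFinrankEq _ _ h₀).symm)
  have e₁ : {s // ¬p₁ s ∧ ¬p₂ s} ≃ {t // ¬q₁ t ∧ ¬q₂ t} :=
    M.basisH1.indexEquiv ((N.basisH1).map (LinearEquiv.ofFinrankEq _ _ h₁).symm)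
  obtain ⟨e, he⟩ := exists_sum_equiv_sum_of_fibers (f := fun s => (p₁ s, p₂ s))
    (f' := fun t => (q₁ t, q₂ t)) (h := fun s : ℕ ⊕ ℕ => (s.isLeft = true, s.isRight = true)) <| by
      rintro ⟨c₁, c₂⟩
      by_cases hc₁ : c₁ <;> by_cases hc₂ : c₂
      · exact .inr ⟨by simpa [hc₁, hc₂] using e₀⟩
      · exact .inl (Infinite.of_injective (fun n : ℕ => ⟨.inl n, by simp [hc₁, hc₂]⟩)
          fun m n h => by simpa using h)
      · exact .inl (Infinite.of_injective (fun n : ℕ => ⟨.inr n, by simp [hc₁, hc₂]⟩)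
          fun m n h => by simpa using h)
      · exact .inr ⟨by simpa [hc₁, hc₂] using e₁⟩
  refine ⟨(M.sum (acyclicSumBasis k)).iso (N.sum (acyclicSumBasis k)) e (fun s => ?_) fun s => ?_⟩
  all_goals
    have h := he s
    generalize e s = t at h
    rcases s with s | s <;> rcases t with t | t <;> simp_all

end KDiagram

namespace Virtual

variable {k : Type u} [Field k] {c c' : Virtual (FredholmDiagram k)}

/-- A class of virtual diagrams is monomial if it is a difference of monomial diagrams. -/
def IsMonomial (c : Virtual (FredholmDiagram k)) : Prop :=
  ∃ F₁ F₂ : FredholmDiagram k, F₁.1.IsMonomial ∧ F₂.1.IsMonomial ∧ c = mk F₁ F₂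

lemma IsMonomial.ext (hc : c.IsMonomial) (hc' : c'.IsMonomial) (h₀ : c.H0.dim = c'.H0.dim)
    (h₁ : c.H1.dim = c'.H1.dim) : c = c' := by
  obtain ⟨F₁, F₂, hF₁, hF₂, rfl⟩ := hc
  obtain ⟨G₁, G₂, hG₁, hG₂, rfl⟩ := hc'
  simp only [dim_H0_mk, dim_H1_mk] at h₀ h₁
  obtain ⟨e⟩ := (hF₁.sum hG₂).nonempty_iso_sum_acyclicSum (hG₁.sum hF₂) (F₁.2.sum G₂.2)
    (G₁.2.sum F₂.2) (by rw [F₁.2.finrank_H0_sum G₂.2, G₁.2.finrank_H0_sum F₂.2]; omega)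
    (by rw [F₁.2.finrank_H1_sum G₂.2, G₁.2.finrank_H1_sum F₂.2]; omega)
  exact Quotient.sound ⟨⟨_, KDiagram.isFredholm_acyclicSum⟩, ⟨e⟩⟩

end Virtual

section QuadrantSums

variable {W g : (Fin 2 → ℤ) → ℤ} {C : ℤ}

/-- The sum of `W` over the quadrant `a ≤ d`: the dimension of `H⁰` of the model `M_{W,d}`. -/
noncomputable def lowerSum (W : (Fin 2 → ℤ) → ℤ) (d : Fin 2 → ℤ) : ℤ := ∑ᶠ a ∈ Set.Iic d, W a

/-- The sum of `W` over the quadrant `a > d` (in both coordinates): the dimension of `H¹` of the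
model `M_{W,d}`. -/
noncomputable def upperSum (W : (Fin 2 → ℤ) → ℤ) (d : Fin 2 → ℤ) : ℤ :=
  ∑ᶠ a ∈ Set.Ici (d + 1), W a

lemma upperSum_dualWeight (W : (Fin 2 → ℤ) → ℤ) (L d : Fin 2 → ℤ) :
    upperSum (dualWeight W L) d = lowerSum W (L - d - 1) := by
  refine finsum_mem_eq_of_bijOn (L - ·) (Equiv.bijOn (Equiv.subLeft L) fun a => ?_) fun _ _ => rfl
  simp [Pi.le_def, Fin.forall_fin_two]
  omega

lemma lowerSum_dualWeight (W : (Fin 2 → ℤ) → ℤ) (L d : Fin 2 → ℤ) :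
    lowerSum (dualWeight W L) d = upperSum W (L - d - 1) := by
  have h := upperSum_dualWeight (dualWeight W L) L (L - d - 1)
  have hW : dualWeight (dualWeight W L) L = W := by ext a; simp [dualWeight]
  rw [hW, show L - (L - d - 1) - 1 = d by abel] at h
  exact h.symm

/-- Inclusion–exclusion over the four quadrants involved. -/
lemma InitiallyZero.weight_lowerSum (h : InitiallyZero W) : weight (lowerSum W) = W := by
  ext d
  have hfin (e : Fin 2 → ℤ) : (Set.Iic e ∩ W.support).Finite := h.finite_le e
  have hinter : Set.Iic (d - Pi.single 0 1) ∩ Set.Iic (d - Pi.single 1 1) =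
      Set.Iic (d - (Pi.single 0 1 + Pi.single 1 1)) := by
    ext a
    simp [Pi.le_def, Fin.forall_fin_two]
    omega
  have hunion : insert d (Set.Iic (d - Pi.single 0 1) ∪ Set.Iic (d - Pi.single 1 1)) =
      Set.Iic d := by
    ext a
    simp [Pi.le_def, Fin.forall_fin_two, funext_iff]
    omega
  have hd : d ∉ Set.Iic (d - Pi.single 0 1) ∪ Set.Iic (d - Pi.single 1 1) := by
    simp [Pi.le_def, Fin.forall_fin_two]
  have hsum := finsum_mem_union_inter' (hfin (d - Pi.single 0 1)) (hfin (d - Pi.single 1 1))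
  have hinsert := finsum_mem_insert' W hd
    (by rw [Set.union_inter_distrib_right]; exact (hfin _).union (hfin _))
  rw [hinter] at hsum
  rw [hunion] at hinsert
  rw [weight_two, lowerSum, lowerSum, lowerSum, lowerSum, hinsert]
  linarith

lemma initiallyZero_lowerSum (h : InitiallyZero W) : InitiallyZero (lowerSum W) := by
  obtain ⟨b, hb⟩ := h
  refine ⟨b, fun d hd => finsum_mem_eq_zero_of_forall_eq_zero fun a ha => hb a ?_⟩
  exact (Finset.sum_le_sum fun i _ => ha i).trans hd

/-- Induction on the degree: `𝔪 f (d)` determines `f d` from values of `f` in lower degrees. -/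
lemma InitiallyZero.eq_of_weight_eq {f g : (Fin 2 → ℤ) → ℤ} (hf : InitiallyZero f)
    (hg : InitiallyZero g) (h : weight f = weight g) : f = g := by
  obtain ⟨a, ha⟩ := hf
  obtain ⟨b, hb⟩ := hg
  have hlow (N : ℕ) (d : Fin 2 → ℤ) (hd : deg d ≤ min a b + N) : f d = g d := by
    induction N generalizing d with
    | zero => rw [ha d (by grind), hb d (by grind)]
    | succ N ih =>
      have hW := congrFun h d
      push_cast at hd
      rw [weight_two, weight_two, ih (d - Pi.single 0 1) (by rw [deg_sub, deg_single]; linarith),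
        ih (d - Pi.single 1 1) (by rw [deg_sub, deg_single]; linarith),
        ih (d - (Pi.single 0 1 + Pi.single 1 1))
          (by rw [deg_sub, deg_add, deg_single, deg_single]; linarith)] at hW
      linarith
  exact funext fun d => hlow (deg d - min a b).toNat d (by grind)

lemma weight_riemannDual (g : (Fin 2 → ℤ) → ℤ) (C : ℤ) (K : Fin 2 → ℤ) :
    weight (riemannDual g C K) = dualWeight (weight g) (K + 1) := by
  ext d
  have h₀ : K + 1 - d - Pi.single 0 1 = K - (d - Pi.single 1 1) := by
    ext i; fin_cases i <;> simp <;> ring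
  have h₁ : K + 1 - d - Pi.single 1 1 = K - (d - Pi.single 0 1) := by
    ext i; fin_cases i <;> simp <;> ring
  have h₂ : K + 1 - d - (Pi.single 0 1 + Pi.single 1 1) = K - d := by
    ext i; fin_cases i <;> simp <;> ring
  have h₃ : K + 1 - d = K - (d - (Pi.single 0 1 + Pi.single 1 1)) := by
    ext i; fin_cases i <;> simp <;> ring
  rw [dualWeight, weight_two, weight_two, h₀, h₁, h₂, h₃]
  simp only [riemannDual, deg_sub, deg_add, deg_single]
  ring

lemma IsRiemannFunction.lowerSum_weight (hg : IsRiemannFunction g C) : lowerSum (weight g) = g :=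
  (initiallyZero_lowerSum hg.weight_initiallyZero).eq_of_weight_eq hg.1
    hg.weight_initiallyZero.weight_lowerSum

lemma IsRiemannFunction.upperSum_weight (hg : IsRiemannFunction g C) (d : Fin 2 → ℤ) :
    upperSum (weight g) d = g d - deg d - C := by
  have h := congrFun (hg.riemannDual 0).lowerSum_weight (-d)
  rw [weight_riemannDual, lowerSum_dualWeight, show 0 + 1 - -d - 1 = d by abel] at h
  rw [h, _root_.riemannDual, zero_sub, neg_neg]

lemma natCard_multi_mem (hW : 0 ≤ W) {T : Set (Fin 2 → ℤ)} (hT : {a ∈ T | W a ≠ 0}.Finite) :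
    (Nat.card {s : Multi W // s.1.1 ∈ T} : ℤ) = ∑ᶠ a ∈ T, W a := by
  have hmem (a : Fin 2 → ℤ) (m : ℕ) : (1 ≤ m ∧ (m : ℤ) ≤ W a) ∧ a ∈ T ↔
      (⟨a, m⟩ : Σ _ : Fin 2 → ℤ, ℕ) ∈ hT.toFinset.sigma fun a => Finset.Icc 1 (W a).toNat := by
    simp only [Finset.mem_sigma, Set.Finite.mem_toFinset, Finset.mem_Icc, Set.mem_ofPred_eq]
    grind
  let e : {s : Multi W // s.1.1 ∈ T} ≃
      hT.toFinset.sigma fun a => Finset.Icc 1 (W a).toNat :=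
    (Equiv.subtypeSubtypeEquivSubtypeInter _ (·.1 ∈ T)).trans
      ((Equiv.sigmaEquivProd _ _).symm.subtypeEquiv fun p => hmem p.1 p.2)
  rw [Nat.card_congr e, Nat.card_eq_fintype_card, Fintype.card_coe, Finset.card_sigma]
  simp only [Nat.card_Icc, add_tsub_cancel_right, Nat.cast_sum, Int.toNat_of_nonneg (hW _)]
  exact (finsum_mem_eq_sum W hT).symm

lemma InitiallyZero.natCard_multi_le (h : InitiallyZero W) (hW : 0 ≤ W) (d : Fin 2 → ℤ) :
    (Nat.card {s : Multi W // s.1.1 0 ≤ d 0 ∧ s.1.1 1 ≤ d 1} : ℤ) = lowerSum W d := by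
  refine Eq.trans ?_ (natCard_multi_mem hW (h.finite_le d))
  refine mod_cast Nat.card_congr (.subtypeEquivRight fun s => ?_)
  exact (Fin.forall_fin_two (p := fun i => s.1.1 i ≤ d i)).symm

lemma EventuallyZero.natCard_multi_not_le (h : EventuallyZero W) (hW : 0 ≤ W) (d : Fin 2 → ℤ) :
    (Nat.card {s : Multi W // ¬s.1.1 0 ≤ d 0 ∧ ¬s.1.1 1 ≤ d 1} : ℤ) = upperSum W d := by
  refine Eq.trans ?_ (natCard_multi_mem hW (h.finite_ge d))
  refine mod_cast Nat.card_congr (.subtypeEquivRight fun s => ?_)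
  exact (and_congr not_le not_le).trans (Fin.forall_fin_two (p := fun i => d i < s.1.1 i)).symm

end QuadrantSums

namespace KDiagram

open Module

variable {k : Type u} [Field k] {W : (Fin 2 → ℤ) → ℤ}

lemma isMonomial_indicatorSum (W : (Fin 2 → ℤ) → ℤ) (d : Fin 2 → ℤ) :
    (indicatorSum k W d).IsMonomial :=
  (indicatorSumBasis k W d).isMonomial

lemma finrank_H0_indicatorSum (h : InitiallyZero W) (hW : 0 ≤ W) (d : Fin 2 → ℤ) :
    (finrank k (indicatorSum k W d).H0 : ℤ) = lowerSum W d := by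
  rw [finrank_eq_nat_card_basis (indicatorSumBasis k W d).basisH0, h.natCard_multi_le hW]

lemma finrank_H1_indicatorSum (h : EventuallyZero W) (hW : 0 ≤ W) (d : Fin 2 → ℤ) :
    (finrank k (indicatorSum k W d).H1 : ℤ) = upperSum W d := by
  rw [finrank_eq_nat_card_basis (indicatorSumBasis k W d).basisH1, h.natCard_multi_not_le hW]

end KDiagram

lemma IsPerfectMatching.nonneg {W : (Fin 2 → ℤ) → ℤ} (h : IsPerfectMatching W) : 0 ≤ W := by
  obtain ⟨-, -, π, hπ⟩ := h
  intro a
  rw [hπ]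
  positivity

namespace KDiagram

open Module

variable {k : Type u} [Field k] {S : Type} {P : S → (Fin 2 → ℤ) → ℤ}

lemma isMonomial_matchingSum [Countable S] (hP : ∀ l, IsPerfectMatching (P l)) (d : Fin 2 → ℤ) :
    (matchingSum k P d).IsMonomial :=
  (matchingSumBasis k hP d).isMonomial

lemma isFredholm_matchingSum [Finite S] (hP : ∀ l, IsPerfectMatching (P l)) (d : Fin 2 → ℤ) :
    (matchingSum k P d).IsFredholm :=
  have := fun l => (hP l).1.finite_multi_le d
  have := finite_sigma_multi_not_le hP d
  have : Finite {s : Σ l, Multi (P l) // s.2.1.1 0 ≤ d 0 ∧ s.2.1.1 1 ≤ d 1} :=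
    .of_equiv (Σ l, {s : Multi (P l) // s.1.1 0 ≤ d 0 ∧ s.1.1 1 ≤ d 1}) sigmaSubtypeEquiv
  (matchingSumBasis k hP d).isFredholm

lemma finrank_H0_matchingSum [Fintype S] (hP : ∀ l, IsPerfectMatching (P l)) (d : Fin 2 → ℤ) :
    (finrank k (matchingSum k P d).H0 : ℤ) = ∑ l, lowerSum (P l) d := by
  have := fun l => (hP l).1.finite_multi_le d
  rw [finrank_eq_nat_card_basis (matchingSumBasis k hP d).basisH0,
    ← Nat.card_congr (sigmaSubtypeEquiv
      (p := fun l (s : Multi (P l)) => s.1.1 0 ≤ d 0 ∧ s.1.1 1 ≤ d 1)),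
    Nat.card_sigma, Nat.cast_sum]
  exact Finset.sum_congr rfl fun l _ => (hP l).1.natCard_multi_le (hP l).nonneg d

lemma finrank_H1_matchingSum [Fintype S] (hP : ∀ l, IsPerfectMatching (P l)) (d : Fin 2 → ℤ) :
    (finrank k (matchingSum k P d).H1 : ℤ) = ∑ l, upperSum (P l) d := by
  have := fun l => (hP l).2.1.finite_multi_not_le d
  rw [finrank_eq_nat_card_basis (matchingSumBasis k hP d).basisH1,
    ← Nat.card_congr (sigmaSubtypeEquiv
      (p := fun l (s : Multi (P l)) => ¬s.1.1 0 ≤ d 0 ∧ ¬s.1.1 1 ≤ d 1)),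
    Nat.card_sigma, Nat.cast_sum]
  exact Finset.sum_congr rfl fun l _ => (hP l).2.1.natCard_multi_not_le (hP l).nonneg d

end KDiagram

section WeightModel

variable {k : Type u} [Field k] {W W' : (Fin 2 → ℤ) → ℤ} {d d' : Fin 2 → ℤ}
  {h : InitiallyZero W} {h' : EventuallyZero W}

lemma isMonomial_weightModel : (weightModel k W h h' d).IsMonomial :=
  ⟨_, _, KDiagram.isMonomial_indicatorSum _ d, KDiagram.isMonomial_indicatorSum _ d, rfl⟩

lemma dim_H0_weightModel : (weightModel k W h h' d).H0.dim = lowerSum W d := by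
  have h₁ := h.comp (max · 0) (by simp)
  have h₂ := h.comp (fun x => max (-x) 0) (by simp)
  refine (Virtual.dim_H0_mk _ _).trans ?_
  rw [KDiagram.finrank_H0_indicatorSum h₁ fun _ => le_max_right _ _,
    KDiagram.finrank_H0_indicatorSum h₂ fun _ => le_max_right _ _, sub_eq_iff_eq_add,
    lowerSum, lowerSum, lowerSum,
    ← finsum_mem_add_distrib' (s := Set.Iic d) (h.finite_le d) (h₂.finite_le d)]
  exact finsum_congr fun a => finsum_congr fun _ => by omega

lemma dim_H1_weightModel : (weightModel k W h h' d).H1.dim = upperSum W d := by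
  have h₁ := h'.comp (max · 0) (by simp)
  have h₂ := h'.comp (fun x => max (-x) 0) (by simp)
  refine (Virtual.dim_H1_mk _ _).trans ?_
  rw [KDiagram.finrank_H1_indicatorSum h₁ fun _ => le_max_right _ _,
    KDiagram.finrank_H1_indicatorSum h₂ fun _ => le_max_right _ _, sub_eq_iff_eq_add,
    upperSum, upperSum, upperSum,
    ← finsum_mem_add_distrib' (s := Set.Ici (d + 1)) (h'.finite_ge d) (h₂.finite_ge d)]
  exact finsum_congr fun a => finsum_congr fun _ => by omega

lemma weightModel_eq_of_sums_eq {hW : InitiallyZero W'} {hW' : EventuallyZero W'}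
    (h₀ : lowerSum W d = lowerSum W' d') (h₁ : upperSum W d = upperSum W' d') :
    weightModel k W h h' d = weightModel k W' hW hW' d' :=
  isMonomial_weightModel.ext isMonomial_weightModel
    (by rwa [dim_H0_weightModel, dim_H0_weightModel])
    (by rwa [dim_H1_weightModel, dim_H1_weightModel])

lemma MatchingDecomposition.finsum_mem_eq (D : MatchingDecomposition W) {T : Set (Fin 2 → ℤ)}
    (hpos : ∀ l, (T ∩ (D.pos l).support).Finite) (hneg : ∀ l, (T ∩ (D.neg l).support).Finite) :
    ∑ᶠ a ∈ T, W a = ∑ l, ∑ᶠ a ∈ T, D.pos l a - ∑ l, ∑ᶠ a ∈ T, D.neg l a := by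
  simp only [← Set.support_indicator] at hpos hneg
  have h (a : Fin 2 → ℤ) : T.indicator W a =
      ∑ l, T.indicator (D.pos l) a - ∑ l, T.indicator (D.neg l) a := by
    by_cases ha : a ∈ T <;> simp [ha, D.eq_sub a]
  simp only [finsum_mem_def]
  rw [finsum_congr h, finsum_sub_distrib (.sum hpos _) (.sum hneg _),
    finsum_sum_comm _ _ fun l _ => hpos l, finsum_sum_comm _ _ fun l _ => hneg l]

lemma MatchingDecomposition.lowerSum_eq (D : MatchingDecomposition W) (d : Fin 2 → ℤ) :
    lowerSum W d = ∑ l, lowerSum (D.pos l) d - ∑ l, lowerSum (D.neg l) d :=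
  D.finsum_mem_eq (fun l => (D.pos_perfect l).1.finite_le d)
    fun l => (D.neg_perfect l).1.finite_le d

lemma MatchingDecomposition.upperSum_eq (D : MatchingDecomposition W) (d : Fin 2 → ℤ) :
    upperSum W d = ∑ l, upperSum (D.pos l) d - ∑ l, upperSum (D.neg l) d :=
  D.finsum_mem_eq (fun l => (D.pos_perfect l).2.1.finite_ge d)
    fun l => (D.neg_perfect l).2.1.finite_ge d

lemma representedBy_weightModel (D : MatchingDecomposition W) :
    RepresentedBy (weightModel k W h h' d) (matchingSum k D.pos d) (matchingSum k D.neg d) := by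
  refine ⟨KDiagram.isFredholm_matchingSum D.pos_perfect d,
    KDiagram.isFredholm_matchingSum D.neg_perfect d, isMonomial_weightModel.ext
      ⟨_, _, KDiagram.isMonomial_matchingSum D.pos_perfect d,
        KDiagram.isMonomial_matchingSum D.neg_perfect d, rfl⟩ ?_ ?_⟩
  · refine Eq.trans ?_ (Virtual.dim_H0_mk _ _).symm
    rw [dim_H0_weightModel, KDiagram.finrank_H0_matchingSum D.pos_perfect,
      KDiagram.finrank_H0_matchingSum D.neg_perfect, D.lowerSum_eq]
  · refine Eq.trans ?_ (Virtual.dim_H1_mk _ _).symm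
    rw [dim_H1_weightModel, KDiagram.finrank_H1_matchingSum D.pos_perfect,
      KDiagram.finrank_H1_matchingSum D.neg_perfect, D.upperSum_eq]

/-- The decomposition of the dual weight `W*_L` into the duals of the matchings in `D`. -/
def MatchingDecomposition.dual (D : MatchingDecomposition W) (L : Fin 2 → ℤ) :
    MatchingDecomposition (dualWeight W L) where
  r := D.r
  pos l := dualWeight (D.pos l) L
  neg l := dualWeight (D.neg l) L
  pos_perfect l := (D.pos_perfect l).dualWeight L
  neg_perfect l := (D.neg_perfect l).dualWeight L
  eq_sub a := D.eq_sub (L - a)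

end WeightModel

section RiemannModel

variable {k : Type u} [Field k] {n : ℕ} {f : (Fin n → ℤ) → ℤ} {C : ℤ} {d d' : Fin n → ℤ}
  {i' j' : Fin n} {a : Fin 2 → ℤ}

lemma lowerSum_weight_restrictTwo (hf : IsRiemannFunction f C)
    (hd : d' + Pi.single i' (a 0) + Pi.single j' (a 1) = d) :
    lowerSum (weight (restrictTwo f i' j' d')) a = f d := by
  rw [(hf.restrictTwo i' j' d').lowerSum_weight, _root_.restrictTwo, hd]

lemma upperSum_weight_restrictTwo (hf : IsRiemannFunction f C)
    (hd : d' + Pi.single i' (a 0) + Pi.single j' (a 1) = d) :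
    upperSum (weight (restrictTwo f i' j' d')) a = f d - deg d - C := by
  rw [(hf.restrictTwo i' j' d').upperSum_weight, _root_.restrictTwo, hd, ← hd, deg_add, deg_add,
    deg_single, deg_single, deg, Fin.sum_univ_two]
  ring

lemma restrictionModel_eq_weightModel (hf : IsRiemannFunction f C) (i j : Fin n)
    (hd : d' + Pi.single i' (a 0) + Pi.single j' (a 1) = d) :
    restrictionModel k hf i j d = weightModel k (weight (restrictTwo f i' j' d'))
      (hf.restrictTwo i' j' d').weight_initiallyZero
      (hf.restrictTwo i' j' d').weight_eventuallyZero a :=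
  weightModel_eq_of_sums_eq
    (by rw [lowerSum_weight_restrictTwo hf (d := d) (by simp), lowerSum_weight_restrictTwo hf hd])
    (by rw [upperSum_weight_restrictTwo hf (d := d) (by simp), upperSum_weight_restrictTwo hf hd])

lemma restrictionModel_riemannDual_eq_weightModel (hf : IsRiemannFunction f C) (i j : Fin n)
    (K : Fin n → ℤ) (hd : d' + Pi.single i' (a 0) + Pi.single j' (a 1) = d) {e L : Fin 2 → ℤ}
    (hL : L = a + e + 1) :
    restrictionModel k (hf.riemannDual K) i j (K - d) =
      weightModel k (dualWeight (weight (restrictTwo f i' j' d')) L)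
        ((hf.restrictTwo i' j' d').weight_eventuallyZero.dualWeight L)
        ((hf.restrictTwo i' j' d').weight_initiallyZero.dualWeight L) e := by
  have ha : L - e - 1 = a := by rw [hL]; abel
  refine weightModel_eq_of_sums_eq ?_ ?_
  · rw [lowerSum_weight_restrictTwo (hf.riemannDual K) (d := K - d) (by simp), lowerSum_dualWeight,
      ha, upperSum_weight_restrictTwo hf hd, riemannDual, sub_sub_cancel]
  · rw [upperSum_weight_restrictTwo (hf.riemannDual K) (d := K - d) (by simp), upperSum_dualWeight,
      ha, lowerSum_weight_restrictTwo hf hd, riemannDual, sub_sub_cancel, deg_sub]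
    ring

lemma dim_H0_modelAt (hn : 2 ≤ n) (hf : IsRiemannFunction f C) (d : Fin n → ℤ) :
    (modelAt k hn hf d).H0.dim = f d := by
  rw [modelAt, restrictionModel, dim_H0_weightModel,
    lowerSum_weight_restrictTwo hf (d := d) (by simp)]

lemma dim_H1_modelAt (hn : 2 ≤ n) (hf : IsRiemannFunction f C) (d : Fin n → ℤ) :
    (modelAt k hn hf d).H1.dim = f d - deg d - C := by
  rw [modelAt, restrictionModel, dim_H1_weightModel,
    upperSum_weight_restrictTwo hf (d := d) (by simp)]

lemma dual_H0_modelAt (hn : 2 ≤ n) (hf : IsRiemannFunction f C) (K d : Fin n → ℤ) :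
    (modelAt k hn hf d).H0.dual = (modelAt k hn (hf.riemannDual K) (K - d)).H1 := by
  apply Virtual.dim_injective
  rw [Virtual.dim_dual, dim_H0_modelAt, dim_H1_modelAt, riemannDual, sub_sub_cancel, deg_sub]
  ring

lemma dual_H1_modelAt (hn : 2 ≤ n) (hf : IsRiemannFunction f C) (K d : Fin n → ℤ) :
    (modelAt k hn hf d).H1.dual = (modelAt k hn (hf.riemannDual K) (K - d)).H0 := by
  apply Virtual.dim_injective
  rw [Virtual.dim_dual, dim_H1_modelAt, dim_H0_modelAt, riemannDual, sub_sub_cancel]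

end RiemannModel

section Decomposition

open Finset

lemma weight_add {n : ℕ} (f g : (Fin n → ℤ) → ℤ) : weight (f + g) = weight f + weight g := by
  ext d
  simp [weight, mul_add, sum_add_distrib]

/-- The operator `f ↦ 𝔪 f` as an additive map, for pulling subgroups of weights back along it. -/
def weightHom (n : ℕ) : ((Fin n → ℤ) → ℤ) →+ ((Fin n → ℤ) → ℤ) := .mk' weight weight_add

/-- The group generated by the differences of two perfect matchings: its elements are the
differences of sums of equally many perfect matchings. -/
def matchingDifferences : AddSubgroup ((Fin 2 → ℤ) → ℤ) :=
  .closure {W | ∃ P Q, IsPerfectMatching P ∧ IsPerfectMatching Q ∧ P - Q = W}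

/-- The decomposition of `W + (P - Q)` that adds `P` and `Q` to the matchings of a decomposition
of `W`. -/
def MatchingDecomposition.cons {W P Q : (Fin 2 → ℤ) → ℤ} (D : MatchingDecomposition W)
    (hP : IsPerfectMatching P) (hQ : IsPerfectMatching Q) :
    MatchingDecomposition (W + (P - Q)) where
  r := D.r + 1
  pos := Fin.cons P D.pos
  neg := Fin.cons Q D.neg
  pos_perfect := Fin.cons hP D.pos_perfect
  neg_perfect := Fin.cons hQ D.neg_perfect
  eq_sub a := by
    simp only [Pi.add_apply, Pi.sub_apply, D.eq_sub a, Fin.sum_univ_succ, Fin.cons_zero,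
      Fin.cons_succ]
    ring

lemma nonempty_matchingDecomposition_add {P W : (Fin 2 → ℤ) → ℤ} (hP : IsPerfectMatching P)
    (hW : W ∈ matchingDifferences) : Nonempty (MatchingDecomposition (P + W)) := by
  induction hW using AddSubgroup.closure_induction_right with
  | zero => exact ⟨0, fun _ => P, Fin.elim0, fun _ => hP, fun l => l.elim0, by simp⟩
  | add_right W _ _ hdiff ih =>
    obtain ⟨P', Q, hP', hQ, rfl⟩ := hdiff
    obtain ⟨D⟩ := ih
    rw [← add_assoc]
    exact ⟨D.cons hP' hQ⟩
  | add_neg_cancel W _ _ hdiff ih =>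
    obtain ⟨P', Q, hP', hQ, rfl⟩ := hdiff
    obtain ⟨D⟩ := ih
    rw [neg_sub, ← add_assoc]
    exact ⟨D.cons hQ hP'⟩

lemma isPerfectMatching_of_perm (π : Equiv.Perm ℤ) {l u : ℤ} (hl : ∀ x, l < x + π x)
    (hu : ∀ x, x + π x < u) :
    IsPerfectMatching fun a => if a 1 = π (a 0) then 1 else 0 := by
  refine ⟨⟨l, fun a ha => if_neg fun h => ?_⟩, ⟨u, fun a ha => if_neg fun h => ?_⟩,
    π, fun a => rfl⟩
  · have := hl (a 0)
    rw [deg, Fin.sum_univ_two] at ha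
    omega
  · have := hu (a 0)
    rw [deg, Fin.sum_univ_two] at ha
    omega

/-- The indicator function of the antidiagonal of degree `t`, the simplest perfect matching. -/
def antidiagonalIndicator (t : ℤ) : (Fin 2 → ℤ) → ℤ := fun a => if a 1 = t - a 0 then 1 else 0

lemma isPerfectMatching_antidiagonalIndicator (t : ℤ) :
    IsPerfectMatching (antidiagonalIndicator t) :=
  isPerfectMatching_of_perm (Equiv.subLeft t) (l := t - 1) (u := t + 1)
    (fun x => by simp) fun x => by simp

/-- The permutation of `ℤ` that exchanges `x` and `x + 1` for all `x` in a set without consecutive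
elements. -/
def swapSucc (A : ℤ → Prop) [DecidablePred A] (hA : ∀ x, A x → ¬A (x + 1)) : Equiv.Perm ℤ :=
  Function.Involutive.toPerm (fun x => if A x then x + 1 else if A (x - 1) then x - 1 else x)
    fun x => by
      by_cases h : A x
      · simp [h, hA x h]
      · by_cases h' : A (x - 1) <;> simp [h, h']

/-- Each point `(x, s - x)` of the set contributes a square of four signs, and adding that square
to the antidiagonal of degree `s + 1` exchanges the values of its matching at `x` and `x + 1`. -/
lemma weight_indicator_antidiagonal_mem (s : ℤ) (A : ℤ → Prop) [DecidablePred A]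
    (hA : ∀ x, A x → ¬A (x + 1)) :
    weight (fun a => if A (a 0) ∧ a 0 + a 1 = s then 1 else 0) ∈ matchingDifferences := by
  let π : Equiv.Perm ℤ := (swapSucc A hA).trans (Equiv.subLeft (s + 1))
  have hπ (x : ℤ) : π x = s + 1 - if A x then x + 1 else if A (x - 1) then x - 1 else x := rfl
  have hperfect := isPerfectMatching_of_perm π (l := s - 1) (u := s + 3)
    (fun x => by rw [hπ]; split_ifs <;> omega) (fun x => by rw [hπ]; split_ifs <;> omega)
  refine AddSubgroup.subset_closure
    ⟨_, _, hperfect, isPerfectMatching_antidiagonalIndicator (s + 1), funext fun a => ?_⟩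
  have := hA (a 0 - 1)
  rw [sub_add_cancel] at this
  simp only [hπ, Pi.sub_apply, antidiagonalIndicator, weight_two, Pi.single_eq_same, ne_eq,
    one_ne_zero, not_false_eq_true, Pi.single_eq_of_ne, sub_zero, zero_ne_one, Pi.add_apply,
    add_zero, zero_add]
  grind

lemma weight_indicator_mem (Z : (Fin 2 → ℤ) → Prop) [DecidablePred Z] (l u : ℤ)
    (hZ : ∀ a, Z a → l ≤ deg a ∧ deg a ≤ u) :
    weight (fun a => if Z a then 1 else 0) ∈ matchingDifferences := by
  -- Splitting each antidiagonal by the parity of `a 0` leaves no consecutive points.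
  let F (s ε : ℤ) : (Fin 2 → ℤ) → ℤ := fun a =>
    if (Z ![a 0, s - a 0] ∧ a 0 % 2 = ε) ∧ a 0 + a 1 = s then 1 else 0
  have hF (s ε : ℤ) : F s ε ∈ matchingDifferences.comap (weightHom 2) :=
    weight_indicator_antidiagonal_mem s (fun x => Z ![x, s - x] ∧ x % 2 = ε) (by grind)
  have hlevel (s : ℤ) (a : Fin 2 → ℤ) :
      (F s 0 + F s 1) a = if deg a = s then if Z a then 1 else 0 else 0 := by
    rw [deg, Fin.sum_univ_two]
    by_cases hs : a 0 + a 1 = s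
    · have ha : ![a 0, s - a 0] = a := by
        ext i
        fin_cases i <;> simp [← hs]
      simp only [F, Pi.add_apply, ha, hs]
      grind
    · simp [F, hs]
  have hsum : (fun a => if Z a then 1 else 0) = ∑ s ∈ Icc l u, (F s 0 + F s 1) := by
    ext a
    rw [Finset.sum_apply, sum_congr rfl fun s _ => hlevel s a, sum_ite_eq]
    grind
  rw [hsum]
  exact AddSubgroup.sum_mem (matchingDifferences.comap (weightHom 2))
    fun s _ => AddSubgroup.add_mem _ (hF s 0) (hF s 1)

lemma sum_Icc_one_ite_le {x B : ℤ} (hx : x ≤ B) :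
    ∑ m ∈ Icc 1 B, (if m ≤ x then 1 else 0 : ℤ) = max x 0 := by
  have hfilter : {m ∈ Icc 1 B | m ≤ x} = Icc 1 x := by grind
  rw [sum_boole, hfilter, Int.card_Icc]
  omega

lemma weight_mem_of_bounded {h : (Fin 2 → ℤ) → ℤ} (h₀ : InitiallyZero h) (h₁ : EventuallyZero h)
    {B : ℤ} (hB : ∀ a, |h a| ≤ B) : weight h ∈ matchingDifferences := by
  obtain ⟨l, hl⟩ := h₀
  obtain ⟨u, hu⟩ := h₁
  have hlayers : h = ∑ m ∈ Icc 1 B, ((fun a => if m ≤ h a then 1 else 0) -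
      fun a => if m ≤ -h a then 1 else 0) := by
    ext a
    have ha := abs_le.1 (hB a)
    rw [Finset.sum_apply]
    simp only [Pi.sub_apply, sum_sub_distrib]
    rw [sum_Icc_one_ite_le ha.2, sum_Icc_one_ite_le (neg_le.1 ha.1)]
    omega
  have hband (a : Fin 2 → ℤ) (ha : h a ≠ 0) : l ≤ deg a ∧ deg a ≤ u := by grind
  suffices h ∈ matchingDifferences.comap (weightHom 2) from this
  rw [hlayers]
  refine AddSubgroup.sum_mem _ fun m hm => AddSubgroup.sub_mem _ ?_ ?_
  · exact weight_indicator_mem (fun a => m ≤ h a) l u fun a ha => hband a (by grind)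
  · exact weight_indicator_mem (fun a => m ≤ -h a) l u fun a ha => hband a (by grind)

lemma exists_bound_of_weight_bounded {h : (Fin 2 → ℤ) → ℤ} (h₀ : InitiallyZero h)
    (h₁ : EventuallyZero h) {M : ℤ} (hM : ∀ a, |weight h a| ≤ M) : ∃ B, ∀ a, |h a| ≤ B := by
  obtain ⟨l, hl⟩ := h₀
  obtain ⟨u, hu⟩ := h₁
  suffices ∀ N : ℕ, ∃ B, ∀ a, deg a ≤ l + N → |h a| ≤ B by
    obtain ⟨B, hB⟩ := this (u - l).toNat
    refine ⟨max B 0, fun a => ?_⟩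
    rcases le_total u (deg a) with ha | ha
    · simp [hu a ha]
    · exact (hB a (by omega)).trans (le_max_left _ _)
  intro N
  induction N with
  | zero => exact ⟨0, fun a ha => by rw [hl a (by simpa using ha), abs_zero]⟩
  | succ N ih =>
    obtain ⟨B, hB⟩ := ih
    refine ⟨M + 3 * B, fun a ha => ?_⟩
    push_cast at ha
    have h₁ := abs_le.1 (hB (a - Pi.single 0 1) (by rw [deg_sub, deg_single]; linarith))
    have h₂ := abs_le.1 (hB (a - Pi.single 1 1) (by rw [deg_sub, deg_single]; linarith))
    have h₃ := abs_le.1 (hB (a - (Pi.single 0 1 + Pi.single 1 1))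
      (by rw [deg_sub, deg_add, deg_single, deg_single]; linarith))
    have h₄ := abs_le.1 (hM a)
    rw [weight_two] at h₄
    rw [abs_le]
    constructor <;> linarith

lemma weight_max_deg (C : ℤ) :
    weight (fun a : Fin 2 → ℤ => max (deg a + C) 0) = antidiagonalIndicator (1 - C) := by
  ext a
  simp only [weight_two, deg_sub, deg_add, deg_single, antidiagonalIndicator]
  rw [deg, Fin.sum_univ_two]
  split_ifs <;> omega

lemma IsRiemannFunction.nonempty_matchingDecomposition {g : (Fin 2 → ℤ) → ℤ} {C : ℤ}
    (hg : IsRiemannFunction g C) {M : ℤ} (hM : ∀ a, |weight g a| ≤ M) :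
    Nonempty (MatchingDecomposition (weight g)) := by
  obtain ⟨⟨l, hl⟩, u, hu⟩ := hg
  -- `j` is a Riemann function with the offset of `g` whose weight is a single perfect matching.
  let j : (Fin 2 → ℤ) → ℤ := fun a => max (deg a + C) 0
  have hgj : weight g = antidiagonalIndicator (1 - C) + weight (g - j) := by
    rw [← weight_max_deg, ← weight_add, add_sub_cancel]
  have h₀ : InitiallyZero (g - j) := ⟨min l (-C), fun a ha => by grind [Pi.sub_apply]⟩
  have h₁ : EventuallyZero (g - j) := ⟨max u (-C), fun a ha => by grind [Pi.sub_apply]⟩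
  have hM' (a : Fin 2 → ℤ) : |weight (g - j) a| ≤ M + 1 := by
    have ha := hM a
    rw [hgj, Pi.add_apply, antidiagonalIndicator] at ha
    grind
  obtain ⟨B, hB⟩ := exists_bound_of_weight_bounded h₀ h₁ hM'
  rw [hgj]
  exact nonempty_matchingDecomposition_add (isPerfectMatching_antidiagonalIndicator _)
    (weight_mem_of_bounded h₀ h₁ hB)

end Decomposition

theorem mainTheorem11 {k : Type u} [Field k] {n : ℕ} (hn : 2 ≤ n)
    (f : (Fin n → ℤ) → ℤ) (C : ℤ) (hf : IsRiemannFunction f C) (d K : Fin n → ℤ) :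
    -- the class `[M_{f at d}]` does not depend on the choice of two coordinates, nor on the way
    -- in which a weight is written as a difference of sums of perfect matchings
    (∀ i j : Fin n, i ≠ j →
      restrictionModel k hf i j d = modelAt k hn hf d ∧
      (∀ D : MatchingDecomposition (weight (restrictTwo f i j d)),
        RepresentedBy (modelAt k hn hf d) (matchingSum k D.pos 0) (matchingSum k D.neg 0)) ∧
      ((∃ M : ℤ, ∀ a, |weight (restrictTwo f i j d) a| ≤ M) →
        Nonempty (MatchingDecomposition (weight (restrictTwo f i j d))))) ∧
    -- duality
    (modelAt k hn hf d).H0.dual = (modelAt k hn (hf.riemannDual K) (K - d)).H1 ∧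
    (modelAt k hn hf d).H1.dual = (modelAt k hn (hf.riemannDual K) (K - d)).H0 ∧
    -- it arises from the two-variable duality at two coordinates (such as the first two)
    ∀ i j : Fin n, i ≠ j → ∀ d' : Fin n → ℤ, d' = d - Pi.single i (d i) - Pi.single j (d j) →
        modelAt k hn hf d =
          weightModel k (weight (restrictTwo f i j d'))
            (hf.restrictTwo i j d').weight_initiallyZero
            (hf.restrictTwo i j d').weight_eventuallyZero ![d i, d j] ∧
        modelAt k hn (hf.riemannDual K) (K - d) =
          weightModel k (dualWeight (weight (restrictTwo f i j d')) (![K i, K j] + 1))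
            ((hf.restrictTwo i j d').weight_eventuallyZero.dualWeight _)
            ((hf.restrictTwo i j d').weight_initiallyZero.dualWeight _)
            (![K i, K j] - ![d i, d j]) ∧
        ∀ D : MatchingDecomposition (weight (restrictTwo f i j d')),
          RepresentedBy (modelAt k hn hf d)
            (matchingSum k D.pos ![d i, d j]) (matchingSum k D.neg ![d i, d j]) ∧
          RepresentedBy (modelAt k hn (hf.riemannDual K) (K - d))
            (matchingSum k (fun l => dualWeight (D.pos l) (![K i, K j] + 1))
              (![K i, K j] - ![d i, d j]))
            (matchingSum k (fun l => dualWeight (D.neg l) (![K i, K j] + 1))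
              (![K i, K j] - ![d i, d j])) ∧
          HaveCanonicalDualities k D.pos (fun l => dualWeight (D.pos l) (![K i, K j] + 1))
            ![d i, d j] (![K i, K j] - ![d i, d j]) ∧
          HaveCanonicalDualities k D.neg (fun l => dualWeight (D.neg l) (![K i, K j] + 1))
            ![d i, d j] (![K i, K j] - ![d i, d j]) := by
  refine ⟨fun i j _ => ?_, dual_H0_modelAt hn hf K d, dual_H1_modelAt hn hf K d,
    fun i j _ d' hd' => ?_⟩
  · have hmodel : modelAt k hn hf d = restrictionModel k hf i j d :=
      restrictionModel_eq_weightModel hf _ _ (a := 0) (by simp)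
    refine ⟨hmodel.symm, fun D => ?_, fun ⟨M, hM⟩ =>
      (hf.restrictTwo i j d).nonempty_matchingDecomposition hM⟩
    rw [hmodel]
    exact representedBy_weightModel D
  · have hd : d' + Pi.single i (d i) + Pi.single j (d j) = d := by rw [hd']; abel
    have hL : ![K i, K j] + 1 = ![d i, d j] + (![K i, K j] - ![d i, d j]) + 1 := by abel
    have hmodel : modelAt k hn hf d = _ :=
      restrictionModel_eq_weightModel hf _ _ (a := ![d i, d j]) hd
    have hdual : modelAt k hn (hf.riemannDual K) (K - d) = _ :=
      restrictionModel_riemannDual_eq_weightModel hf _ _ K (a := ![d i, d j]) hd hL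
    refine ⟨hmodel, hdual, fun D => ⟨?_, ?_, KDiagram.haveCanonicalDualities D.pos_perfect hL,
      KDiagram.haveCanonicalDualities D.neg_perfect hL⟩⟩
    · rw [hmodel]
      exact representedBy_weightModel D
    · rw [hdual]
      exact representedBy_weightModel (D.dual _)
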